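/- **Setting.** Let $d\ge 0$, $N\ge 1$, $\mathcal S=\{1,\dots,N\}$, and let $Q(x)=(q_{ij}(x))_{i,j\in\mathcal S}$, $x\in\mathbb R^d$, be conservative irreducible $Q$-matrices. For each $n$ let $Q^{(n)}(x)=(q^{(n)}_{ij}(x))$ be of threshold type, i.e. either $$Q^{(n)}(x)=\sum_{k=1}^{m_n+1}Q^{n,k}\,\mathbf 1_{[\alpha^n_{k-1},\alpha^n_k)}(|x|),\qquad 0=\alpha^n_0<\alpha^n_1<\dots<\alpha^n_{m_n}<\alpha^n_{m_n+1}=\infty,$$ or, when $d=1$, $Q^{(n)}(x)=Q^{n,0}\mathbf 1_{(-\infty,\alpha_0^n)}(x)+\sum_{k=1}^{m_n+1}Q^{n,k}\mathbf 1_{[\alpha^n_{k-1},\alpha^n_k)}(x)$ with $-\infty<\alpha^n_0<\dots<\alpha^n_{m_n+1}=\infty$, where all $Q^{n,k}$ are conservative irreducible $Q$-matrices. Put $$\Theta_n=\sup_{x\in\mathbb R^d}\max_{i\in\mathcal S}\sum_{j\ne i}\big|q^{(n)}_{ij}(x)-q_{ij}(x)\big| .$$ Let $K_0<\infty$ satisfy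 $-q_{ii}(x)\le K_0$ and $-q^{(n)}_{ii}(x)\le K_0$ for all $n,x,i$, and let $\kappa_1\ge(2N-1)NK_0$. For $i\neq j$ let $\Gamma_{ij}(x)=[\ell_{ij},\ell_{ij}+q_{ij}(x))$ with $$\ell_{ij}=2(i-1)NK_0-(i-j)K_0\ \ (j<i),\qquad \ell_{ij}=2(i-1)NK_0+(j-i-1)K_0\ \ (j>i),$$ and let $\vartheta(x,i,z)=j-i$ if $z\in\Gamma_{ij}(x)$ for some $j\ne i$, and $\vartheta(x,i,z)=0$ otherwise. Define $\vartheta^{(n)}$ in the same way from $Q^{(n)}$, with the same $\ell_{ij}$. On a filtered probability space let $B$ be a $d$-dimensional Brownian motion and $\mathcal N$ a Poisson random measure on $[0,\infty)\times[0,\kappa_1]$ with intensity $dt\,dz$, both with respect to the filtration and independent of each other. Let $(X,\Lambda)$ and $(X^{(n)},\Lambda^{(n)})$ be adapted processes with values in $\mathbb R^d\times\mathcal S$, with continuous first and càdlàg second component, which satisfy $$dX_t=b(X_t,\Lambda_t)\,dt+\sigma\,dB_t,\qquad d\Lambda_t=\int_{[0,\kappa_1]}\vartheta(X_t,\Lambda_{t-},z)\,\mathcal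 N(dt,dz),$$ $$dX^{(n)}_t=b(X^{(n)}_t,\Lambda^{(n)}_t)\,dt+\sigma\,dB_t,\qquad d\Lambda^{(n)}_t=\int_{[0,\kappa_1]}\vartheta^{(n)}(X^{(n)}_t,\Lambda^{(n)}_{t-},z)\,\mathcal N(dt,dz),$$ with the same $B$, $\mathcal N$ and the same deterministic initial value $(x_0,i_0)$. Write $\mu_t$ and $\mu^n_t$ for the laws of $X_t$ and $X^{(n)}_t$, and $W_1(\mu,\nu)=\inf_\pi\int|x-y|\,\pi(dx,dy)$ (infimum over all couplings $\pi$ of $\mu$ and $\nu$) for the $L_1$-Wasserstein distance. **Theorem.** Suppose that $\sigma\in\mathbb R^{d\times d}$ is constant with $\det\sigma>0$, that $b(x,i)=\hat b(x,i)+Z(x)$, and that for some $K_2,K_3>0$ and all $x,y\in\mathbb R^d$, $i,j\in\mathcal S$, $$|\hat b(x,i)-\hat b(y,i)|+|Z(x)-Z(y)|\le K_2|x-y|,\qquad |\hat b(x,i)|\le K_2,\qquad |q_{ij}(x)-q_{ij}(y)|\le K_3|x-y| .$$ Suppose that $\Theta_n\to0$. Then for every $T>0$ and every $n$, $$\sup_{t\in[0,T]}W_1(\mu^n_t,\mu_t)\le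 2T\,e^{(K_2+2(N-1)K_3)T}\,\Theta_n ,$$ and consequently $\lim_{n\to\infty}\sup_{t\in[0,T]}W_1(\mu^n_t,\mu_t)=0$. -/

import Mathlib

open MeasureTheory ProbabilityTheory Filter Topology
open scoped NNReal ENNReal

namespace HybridSwitching

noncomputable section

/-! ### Transition rate matrices -/

/-- A conservative irreducible `Q`-matrix on the finite state space `Fin N`. -/
structure IsQMatrix {N : ℕ} (q : Matrix (Fin N) (Fin N) ℝ) : Prop where
  off_diag_nonneg : ∀ i j, i ≠ j → 0 ≤ q i j
  conservative : ∀ i, ∑ j, q i j = 0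
  irreducible : ∀ i j, Relation.ReflTransGen (fun k l => 0 < q k l) i j

/-- Threshold type dependence on the norm: `Q x = ∑ k, q k * 1_{[α k, α (k + 1))} (‖x‖)` for a
finite division `0 = α 0 < α 1 < ⋯ < α m < α (m + 1) = ∞` of `[0, ∞)`. -/
def IsRadialThreshold {d N : ℕ}
    (Q : EuclideanSpace ℝ (Fin d) → Matrix (Fin N) (Fin N) ℝ) : Prop :=
  ∃ (m : ℕ) (α : Fin (m + 2) → EReal) (q : Fin (m + 1) → Matrix (Fin N) (Fin N) ℝ),
    StrictMono α ∧ α 0 = 0 ∧ α (Fin.last (m + 1)) = ⊤ ∧ (∀ k, IsQMatrix (q k)) ∧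
    ∀ x, Q x = ∑ k : Fin (m + 1),
      Set.indicator {y : EuclideanSpace ℝ (Fin d) |
        ((‖y‖ : ℝ) : EReal) ∈ Set.Ico (α k.castSucc) (α k.succ)} (fun _ => q k) x

/-- Threshold type dependence on the (signed) coordinate, in dimension one:
`Q x = q⁻ * 1_{(-∞, α 0)} (x) + ∑ k, q k * 1_{[α k, α (k + 1))} (x)` for a finite partition
`-∞ < α 0 < α 1 < ⋯ < α m < α (m + 1) = ∞` of the line. -/
def IsLineThreshold {d N : ℕ}
    (Q : EuclideanSpace ℝ (Fin d) → Matrix (Fin N) (Fin N) ℝ) : Prop :=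
  ∃ (hd : d = 1) (m : ℕ) (α : Fin (m + 2) → EReal) (q₀ : Matrix (Fin N) (Fin N) ℝ)
    (q : Fin (m + 1) → Matrix (Fin N) (Fin N) ℝ),
    StrictMono α ∧ ⊥ < α 0 ∧ α (Fin.last (m + 1)) = ⊤ ∧ IsQMatrix q₀ ∧ (∀ k, IsQMatrix (q k)) ∧
    ∀ x, Q x =
      Set.indicator {y : EuclideanSpace ℝ (Fin d) |
        ((y (Fin.cast hd.symm 0) : ℝ) : EReal) < α 0} (fun _ => q₀) x +
      ∑ k : Fin (m + 1),
        Set.indicator {y : EuclideanSpace ℝ (Fin d) |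
          ((y (Fin.cast hd.symm 0) : ℝ) : EReal) ∈ Set.Ico (α k.castSucc) (α k.succ)}
          (fun _ => q k) x

/-- `sup_x ‖Q' x - Q x‖_{ℓ₁} = sup_x max_i ∑_{j ≠ i} |Q' x i j - Q x i j|`, as an extended
nonnegative number. -/
def rateGap {d N : ℕ} (Q' Q : EuclideanSpace ℝ (Fin d) → Matrix (Fin N) (Fin N) ℝ) : ℝ≥0∞ :=
  ⨆ x, ⨆ i, ∑ j ∈ Finset.univ.erase i, ENNReal.ofReal |Q' x i j - Q x i j|

/-! ### Skorokhod's representation of the switching -/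

/-- The left end point of `Γ i j`. With the one-based labels `n = i + 1` and `k = j + 1` it is
`2 (n - 1) N K - (n - k) K` if `k < n` and `2 (n - 1) N K + (k - n - 1) K` if `k > n`. -/
def gammaLeft (N : ℕ) (K : ℝ) (i j : Fin N) : ℝ :=
  if j < i then 2 * (i : ℝ) * N * K - ((i : ℝ) - (j : ℝ)) * K
  else 2 * (i : ℝ) * N * K + ((j : ℝ) - (i : ℝ) - 1) * K

/-- The interval `Γ i j`, of length `q i j`, with `Γ i i = ∅`. -/
def Gam {N : ℕ} (K : ℝ) (q : Matrix (Fin N) (Fin N) ℝ) (i j : Fin N) : Set ℝ :=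
  if i = j then ∅ else Set.Ico (gammaLeft N K i j) (gammaLeft N K i j + q i j)

open Classical in
/-- The jump size: `j - i` if `z ∈ Γ i j`, and `0` if `z` lies in none of the intervals `Γ i j`.
For fixed `i` the intervals are pairwise disjoint when `q i j ≤ K` for `j ≠ i`, so that at most one
term of the sum is nonzero (see `jump_of_mem`). -/
def jump {N : ℕ} (K : ℝ) (q : Matrix (Fin N) (Fin N) ℝ) (i : Fin N) (z : ℝ) : ℝ :=
  ∑ j : Fin N, if z ∈ Gam K q i j then (j : ℝ) - (i : ℝ) else 0

/-! ### The driving noise -/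

/-- Lebesgue measure on the time axis `[0, ∞)`. -/
def timeMeasure : Measure ℝ≥0 := Measure.comap ((↑) : ℝ≥0 → ℝ) volume

/-- A `d`-dimensional Brownian motion (started at the origin) with respect to a filtration. -/
structure IsFBrownian {Ω : Type*} [mΩ : MeasurableSpace Ω] {d : ℕ} (P : Measure Ω)
    (F : Filtration ℝ≥0 mΩ) (B : ℝ≥0 → Ω → EuclideanSpace ℝ (Fin d)) : Prop where
  adapted : Adapted F B
  brownian : ∀ k : Fin d, IsBrownianReal (fun t ω => B t ω k) P
  indep_coord : iIndepFun (fun (k : Fin d) (ω : Ω) (t : ℝ≥0) => B t ω k) P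
  indep_incr : ∀ s t : ℝ≥0, s ≤ t →
    Indep (MeasurableSpace.comap (fun ω => B t ω - B s ω) inferInstance) (F s) P

/-- A Poisson random measure on `[0, ∞) × ℝ` with intensity measure `dt × dz` on
`[0, ∞) × [0, κ]` (and zero outside), with respect to a filtration. -/
structure IsFPoisson {Ω : Type*} [mΩ : MeasurableSpace Ω] (P : Measure Ω)
    (F : Filtration ℝ≥0 mΩ) (κ : ℝ) (M : Ω → Measure (ℝ≥0 × ℝ)) : Prop where
  measurable : ∀ A, MeasurableSet A → Measurable (fun ω => M ω A)
  integer_valued : ∀ ω A, MeasurableSet A → ∃ n : ℕ∞, M ω A = (n : ℝ≥0∞)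
  law : ∀ A, MeasurableSet A →
    (timeMeasure.prod ((volume : Measure ℝ).restrict (Set.Icc 0 κ))) A ≠ ∞ →
    HasLaw (fun ω => M ω A)
      ((poissonMeasure ((timeMeasure.prod
        ((volume : Measure ℝ).restrict (Set.Icc 0 κ))) A).toNNReal).map
          (fun n : ℕ => (n : ℝ≥0∞))) P
  indep_disjoint : ∀ (n : ℕ) (A : Fin n → Set (ℝ≥0 × ℝ)), (∀ k, MeasurableSet (A k)) →
    Pairwise (Function.onFun Disjoint A) → iIndepFun (fun k ω => M ω (A k)) P
  adapted : ∀ (t : ℝ≥0) (A : Set (ℝ≥0 × ℝ)), MeasurableSet A → A ⊆ Set.Iic t ×ˢ Set.univ →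
    Measurable[F t] (fun ω => M ω A)
  indep_future : ∀ t : ℝ≥0,
    Indep (⨆ (A : Set (ℝ≥0 × ℝ)) (_ : MeasurableSet A ∧ A ⊆ Set.Ioi t ×ˢ Set.univ),
      MeasurableSpace.comap (fun ω => M ω A) inferInstance) (F t) P

/-- The driving noise: a Brownian motion and a Poisson random measure, independent of each other. -/
structure IsNoise {Ω : Type*} [mΩ : MeasurableSpace Ω] {d : ℕ} (P : Measure Ω)
    (F : Filtration ℝ≥0 mΩ) (B : ℝ≥0 → Ω → EuclideanSpace ℝ (Fin d)) (κ : ℝ)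
    (M : Ω → Measure (ℝ≥0 × ℝ)) : Prop where
  brownian : IsFBrownian P F B
  poisson : IsFPoisson P F κ M
  indep : Indep (⨆ t : ℝ≥0, MeasurableSpace.comap (B t) inferInstance)
    (⨆ (A : Set (ℝ≥0 × ℝ)) (_ : MeasurableSet A),
      MeasurableSpace.comap (fun ω => M ω A) inferInstance) P

/-! ### The hybrid system -/

/-- `(X, Λ)` is a solution, started at `(x₀, i₀)`, of
`dX_t = b (X_t, Λ_t) dt + σ dB_t`, `dΛ_t = ∫_{[0, κ]} ϑ (X_t, Λ_{t-}, z) M (dt, dz)`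
with a constant matrix `σ`. The stochastic integral of the constant `σ` is `σ B_t`. The states
are numbered by `Fin N`; only differences of labels enter the second equation. -/
structure IsSolution {Ω : Type*} [mΩ : MeasurableSpace Ω] {d N : ℕ} (P : Measure Ω)
    (F : Filtration ℝ≥0 mΩ) (B : ℝ≥0 → Ω → EuclideanSpace ℝ (Fin d)) (κ : ℝ)
    (M : Ω → Measure (ℝ≥0 × ℝ))
    (b : EuclideanSpace ℝ (Fin d) → Fin N → EuclideanSpace ℝ (Fin d))
    (σ : Matrix (Fin d) (Fin d) ℝ) (K : ℝ)
    (Q : EuclideanSpace ℝ (Fin d) → Matrix (Fin N) (Fin N) ℝ)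
    (x₀ : EuclideanSpace ℝ (Fin d)) (i₀ : Fin N)
    (X : ℝ≥0 → Ω → EuclideanSpace ℝ (Fin d)) (Λ : ℝ≥0 → Ω → Fin N) : Prop where
  adapted_fst : Adapted F X
  adapted_snd : Adapted F Λ
  continuous_fst : ∀ ω, Continuous (fun t => X t ω)
  right_cont_snd : ∀ ω t, ContinuousWithinAt (fun s => Λ s ω) (Set.Ici t) t
  left_lim_snd : ∀ ω t, ∃ i, Tendsto (fun s => Λ s ω) (𝓝[<] t) (𝓝 i)
  eq_fst : ∀ᵐ ω ∂P, ∀ t : ℝ≥0,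
    X t ω = x₀ + (∫ s in Set.Iic t, b (X s ω) (Λ s ω) ∂timeMeasure) + Matrix.toEuclideanLin σ (B t ω)
  eq_snd : ∀ᵐ ω ∂P, ∀ t : ℝ≥0,
    ((Λ t ω : ℕ) : ℝ) = ((i₀ : ℕ) : ℝ) + ∫ p in Set.Iic t ×ˢ Set.Icc 0 κ,
      jump K (Q (X p.1 ω)) (Function.leftLim (fun s => Λ s ω) p.1) p.2 ∂(M ω)

/-! ### The Wasserstein distance -/

/-- The `L₁`-Wasserstein distance, the infimum of `∫ |x - y| π(dx, dy)` over all couplings `π`. -/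
def W₁ {d : ℕ} (μ ν : Measure (EuclideanSpace ℝ (Fin d))) : ℝ≥0∞ :=
  ⨅ (π : Measure (EuclideanSpace ℝ (Fin d) × EuclideanSpace ℝ (Fin d)))
    (_ : π.map Prod.fst = μ ∧ π.map Prod.snd = ν), ∫⁻ p, ‖p.1 - p.2‖ₑ ∂π

/-! ### Sanity check of the jump size -/

theorem jump_of_mem {N : ℕ} {K : ℝ} {q : Matrix (Fin N) (Fin N) ℝ} {i j : Fin N} {z : ℝ}
    (hq : ∀ k, k ≠ i → q i k ≤ K) (hz : z ∈ Gam K q i j) :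
    jump K q i z = (j : ℝ) - (i : ℝ) := by
  classical
  have hK : ∀ k, z ∈ Gam K q i k → k = j := by
    intro k hk
    by_contra hne
    unfold Gam at hz hk
    split_ifs at hz with h1
    · simp at hz
    split_ifs at hk with h2
    · simp at hk
    have a1 := hq j (Ne.symm h1)
    have a2 := hq k (Ne.symm h2)
    obtain ⟨z1, z2⟩ := hz
    obtain ⟨z3, z4⟩ := hk
    have hKpos : 0 ≤ K := by linarith
    have key : ∀ u v : ℝ, u + 1 ≤ v → u * K + K ≤ v * K := by
      intro u v h
      nlinarith
    have cast : ∀ a c : Fin N, a < c → (a : ℝ) + 1 ≤ (c : ℝ) := by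
      intro a c h
      have : (a : ℕ) + 1 ≤ (c : ℕ) := h
      exact_mod_cast this
    rcases lt_or_gt_of_ne hne with h | h <;>
    rcases lt_or_gt_of_ne h1 with h3 | h3 <;>
    rcases lt_or_gt_of_ne h2 with h4 | h4 <;>
    simp only [gammaLeft, h3, h4, not_lt_of_gt, if_true, if_false] at z1 z2 z3 z4 <;>
    have c1 := cast _ _ h <;> have c3 := cast _ _ h3 <;> have c4 := cast _ _ h4 <;>
    nlinarith
  unfold jump
  rw [Finset.sum_eq_single j]
  · simp [hz]
  · intro k _ hk
    rw [if_neg (fun h => hk (hK k h))]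
  · simp

end

end HybridSwitching

open HybridSwitching

/-! Both systems are driven by the same noise, so their joint law at each time is a coupling and
`W₁` is at most the mean distance `u t` of the first components (`W₁_map_le`). Let `p t` be the
probability that the regimes differ at time `t`. Two linear inequalities link `u` and `p`.

The initial values and the terms `σ B` cancel in the difference of the first components. The drifts
differ by at most `K₂` times the distance, plus `2 K₂` when the regimes differ, whence `u t ≤ ∫₀ᵗ
(K₂ u + 2 K₂ p)` (`lintegral_enorm_fst_sub_le`).

For the regimes to separate, the Poisson measure must charge a mark at which the two jump functions,
evaluated at the common state before the jump, disagree (`measure_jump_ne_ne_zero`). The set of such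
points is predictable, so the compensator formula (`lintegral_predictable`) replaces the expected
number of them by an integral against `dt dz`. The intervals `Γ i j` of the two systems share their
left end points, so the disagreeing marks have length at most the `ℓ₁` distance of the rates. Thus
`p t ≤ ∫₀ᵗ (Θ + (N - 1) K₃ u)` (`measure_snd_ne_le`).

Adding twice the second inequality to the first bounds `u + 2 p` by `2 T Θ` plus `K₂ + 2 (N - 1) K₃`
times its own time integral, and Grönwall's inequality gives the constant of the theorem. -/

namespace HybridSwitching

noncomputable section

/-! ### The time axis -/

theorem lintegral_Iic_timeMeasure {f : ℝ → ℝ≥0∞} (t : ℝ≥0) :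
    ∫⁻ s in Set.Iic t, f s ∂timeMeasure = ∫⁻ x in Set.Icc (0 : ℝ) t, f x := by
  have hemb : MeasurableEmbedding ((↑) : ℝ≥0 → ℝ) :=
    MeasurableEmbedding.subtype_coe measurableSet_Ici
  have hset : Set.Iic t = ((↑) : ℝ≥0 → ℝ) ⁻¹' Set.Icc (0 : ℝ) t := by
    ext s
    simp
  have hrange : Set.Icc (0 : ℝ) t ⊆ Set.range ((↑) : ℝ≥0 → ℝ) := by
    rw [NNReal.range_coe]
    exact Set.Icc_subset_Ici_self
  rw [hset, ← hemb.lintegral_map, ← hemb.restrict_map, timeMeasure, hemb.map_comap,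
    Measure.restrict_restrict measurableSet_Icc, Set.inter_eq_self_of_subset_left hrange]

theorem timeMeasure_Iic (t : ℝ≥0) : timeMeasure (Set.Iic t) = t := by
  have h := lintegral_Iic_timeMeasure (f := fun _ => 1) t
  simpa using h

/-- Gives integrability of continuous paths on bounded time intervals, and the σ-finiteness behind
the exchanges of expectation and time integral. -/
instance : IsFiniteMeasureOnCompacts timeMeasure := by
  refine ⟨fun K hK => ?_⟩
  obtain ⟨t, ht⟩ := hK.bddAbove
  calc timeMeasure K ≤ timeMeasure (Set.Iic t) := measure_mono fun s hs => ht hs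
    _ < ∞ := by simp [timeMeasure_Iic]

theorem timeMeasure_singleton_zero : timeMeasure {0} = 0 := by
  have h := timeMeasure_Iic 0
  have : Set.Iic (0 : ℝ≥0) = {0} := by
    ext
    simp
  simpa [this] using h

theorem lintegral_exp_timeMeasure {c : ℝ} (hc : 0 < c) (t : ℝ≥0) :
    ∫⁻ s in Set.Iic t, ENNReal.ofReal (Real.exp (c * s)) ∂timeMeasure =
      ENNReal.ofReal ((Real.exp (c * t) - 1) / c) := by
  rw [lintegral_Iic_timeMeasure (f := fun x => ENNReal.ofReal (Real.exp (c * x))),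
    ← ofReal_integral_eq_lintegral_ofReal]
  · rw [integral_Icc_eq_integral_Ioc, ← intervalIntegral.integral_of_le t.coe_nonneg]
    congr 1
    rw [intervalIntegral.integral_comp_mul_left (fun x => Real.exp x) hc.ne', integral_exp]
    simp
    ring
  · exact (by fun_prop : Continuous fun x : ℝ => Real.exp (c * x)).integrableOn_Icc
  · exact Eventually.of_forall fun x => (Real.exp_pos _).le

/-- Grönwall's inequality in integral form for a bounded function. -/
theorem gronwall_lintegral {f : ℝ≥0 → ℝ≥0∞} {a c C : ℝ} (ha : 0 ≤ a) (hc : 0 < c) {T : ℝ≥0}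
    (hfC : ∀ t ≤ T, f t ≤ ENNReal.ofReal C)
    (hf : ∀ t ≤ T, f t ≤ ENNReal.ofReal a +
      ENNReal.ofReal c * ∫⁻ s in Set.Iic t, f s ∂timeMeasure) :
    ∀ t ≤ T, f t ≤ ENNReal.ofReal (a * Real.exp (c * t)) := by
  -- Picard iteration in the weight `exp (c * t)`: up to time `T`, integrating `c * exp (c * s)`
  -- gives `exp (c * t) - 1 ≤ ρ * exp (c * t)`, so each use of the inequality shrinks the error term
  -- by `ρ < 1`. Only the majorant has to be measurable, not `f`.
  set ρ : ℝ := 1 - Real.exp (-(c * T)) with hρ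
  have hρ0 : 0 ≤ ρ := by
    have : Real.exp (-(c * T)) ≤ 1 := Real.exp_le_one_iff.2 (by simp; positivity)
    linarith
  have hρ1 : ρ < 1 := by
    have := Real.exp_pos (-(c * T))
    linarith
  set D : ℝ := max C 0
  have key : ∀ n : ℕ, ∀ t ≤ T,
      f t ≤ ENNReal.ofReal ((a + D * ρ ^ n) * Real.exp (c * t)) := by
    intro n
    induction n with
    | zero =>
      intro t ht
      refine (hfC t ht).trans (ENNReal.ofReal_le_ofReal ?_)
      have h1 : 1 ≤ Real.exp (c * t) := Real.one_le_exp (by positivity)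
      have h2 : C ≤ D := le_max_left _ _
      have h3 : 0 ≤ D := le_max_right _ _
      rw [pow_zero, mul_one]
      nlinarith
    | succ n ih =>
      intro t ht
      have hD : 0 ≤ D := le_max_right _ _
      have hG : 0 ≤ a + D * ρ ^ n := by positivity
      have hint : ∫⁻ s in Set.Iic t, f s ∂timeMeasure ≤
          ENNReal.ofReal ((a + D * ρ ^ n) * ((Real.exp (c * t) - 1) / c)) := by
        rw [ENNReal.ofReal_mul hG, ← lintegral_exp_timeMeasure hc,
          ← lintegral_const_mul _ (by fun_prop)]
        refine setLIntegral_mono (by fun_prop) fun s hs => ?_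
        rw [← ENNReal.ofReal_mul hG]
        exact ih s (le_trans hs ht)
      have h1 : 1 ≤ Real.exp (c * t) := Real.one_le_exp (by positivity)
      calc f t ≤ ENNReal.ofReal a + ENNReal.ofReal c *
            ENNReal.ofReal ((a + D * ρ ^ n) * ((Real.exp (c * t) - 1) / c)) :=
            (hf t ht).trans (by gcongr)
        _ = ENNReal.ofReal (a + (a + D * ρ ^ n) * (Real.exp (c * t) - 1)) := by
            rw [← ENNReal.ofReal_mul hc.le, ← ENNReal.ofReal_add ha]
            · congr 1
              field_simp
            · have : 0 ≤ (Real.exp (c * t) - 1) / c := div_nonneg (by linarith) hc.le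
              positivity
        _ ≤ _ := by
            refine ENNReal.ofReal_le_ofReal ?_
            have h2 : Real.exp (-(c * T)) * Real.exp (c * t) ≤ 1 := by
              rw [← Real.exp_add, Real.exp_le_one_iff]
              have : (t : ℝ) ≤ T := ht
              nlinarith
            have h3 : 0 ≤ D * ρ ^ n := by positivity
            have h4 : D * ρ ^ (n + 1) = D * ρ ^ n * (1 - Real.exp (-(c * T))) := by
              rw [pow_succ, hρ]
              ring
            rw [h4]
            nlinarith
  intro t ht
  refine ge_of_tendsto' (x := atTop) (f := fun n : ℕ =>
    ENNReal.ofReal ((a + D * ρ ^ n) * Real.exp (c * t))) ?_ fun n => key n t ht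
  refine (ENNReal.continuous_ofReal.tendsto _).comp ?_
  have : Tendsto (fun n : ℕ => (a + D * ρ ^ n) * Real.exp (c * t)) atTop
      (𝓝 ((a + D * 0) * Real.exp (c * t))) :=
    (((tendsto_pow_atTop_nhds_zero_of_lt_one hρ0 hρ1).const_mul D).const_add a).mul_const _
  simpa using this

/-! ### Jumps of two rate matrices -/

theorem volume_Ico_symmDiff_le (l u v : ℝ) :
    volume {z | ¬ (z ∈ Set.Ico l (l + u) ↔ z ∈ Set.Ico l (l + v))} ≤ ENNReal.ofReal |u - v| := by
  have hsub : {z | ¬ (z ∈ Set.Ico l (l + u) ↔ z ∈ Set.Ico l (l + v))} ⊆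
      Set.Ico (l + min u v) (l + max u v) := by
    intro z hz
    simp only [Set.mem_Ico, Set.mem_ofPred_eq] at hz ⊢
    rcases le_total u v with h | h
    · rw [min_eq_left h, max_eq_right h]
      by_contra hcon
      apply hz
      constructor <;> rintro ⟨h1, h2⟩ <;> refine ⟨h1, ?_⟩
      · linarith
      · by_contra h3
        exact hcon ⟨not_lt.1 h3, h2⟩
    · rw [min_eq_right h, max_eq_left h]
      by_contra hcon
      apply hz
      constructor <;> rintro ⟨h1, h2⟩ <;> refine ⟨h1, ?_⟩
      · by_contra h3
        exact hcon ⟨not_lt.1 h3, h2⟩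
      · linarith
  refine (measure_mono hsub).trans_eq ?_
  rw [Real.volume_Ico]
  congr 1
  rw [add_sub_add_left_eq_sub, max_sub_min_eq_abs, abs_sub_comm]

/-- The jump sizes can differ only at a mark lying in exactly one of the two intervals `Γ i j` for
some `j`. Subadditivity suffices; disjointness of the intervals plays no role. -/
theorem volume_jump_ne_le {N : ℕ} (K : ℝ) {q q' : Matrix (Fin N) (Fin N) ℝ} (i : Fin N) :
    volume {z | jump K q i z ≠ jump K q' i z} ≤
      ∑ j ∈ Finset.univ.erase i, ENNReal.ofReal |q i j - q' i j| := by
  have hsub : {z | jump K q i z ≠ jump K q' i z} ⊆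
      ⋃ j ∈ Finset.univ.erase i, {z | ¬ (z ∈ Gam K q i j ↔ z ∈ Gam K q' i j)} := by
    intro z hz
    by_contra hcon
    apply hz
    unfold jump
    refine Finset.sum_congr rfl fun j _ => ?_
    by_cases hij : j = i
    · simp [hij]
    · have : z ∈ Gam K q i j ↔ z ∈ Gam K q' i j := by
        by_contra h
        exact hcon (Set.mem_biUnion (by simp [hij]) h)
      by_cases h : z ∈ Gam K q i j
      · rw [if_pos h, if_pos (this.1 h)]
      · rw [if_neg h, if_neg (fun h' => h (this.2 h'))]
  refine (measure_mono hsub).trans ((measure_biUnion_finset_le _ _).trans ?_)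
  refine Finset.sum_le_sum fun j hj => ?_
  have hij : i ≠ j := (Finset.ne_of_mem_erase hj).symm
  simpa only [Gam, if_neg hij] using
    volume_Ico_symmDiff_le (gammaLeft N K i j) (q i j) (q' i j)

theorem measurable_jump {α : Type*} {m : MeasurableSpace α} {N : ℕ} (K : ℝ)
    {q : α → Matrix (Fin N) (Fin N) ℝ} (hq : ∀ i j, Measurable fun a => q a i j)
    {z : α → ℝ} (hz : Measurable z) (i : Fin N) :
    Measurable fun a => jump K (q a) i (z a) := by
  classical
  unfold jump
  refine Finset.measurable_sum _ fun j _ => Measurable.ite ?_ measurable_const measurable_const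
  unfold Gam
  by_cases hij : i = j
  · simp [hij]
  · simp only [if_neg hij, Set.mem_Ico]
    exact (measurableSet_le measurable_const hz).inter
      (measurableSet_lt hz ((hq i j).const_add _))

theorem measurableSet_jump_ne {α : Type*} {m : MeasurableSpace α} {N : ℕ} (K : ℝ)
    {q q' : α → Matrix (Fin N) (Fin N) ℝ} (hq : ∀ i j, Measurable fun a => q a i j)
    (hq' : ∀ i j, Measurable fun a => q' a i j) {i : α → Fin N} (hi : Measurable i)
    {z : α → ℝ} (hz : Measurable z) :
    MeasurableSet {a | jump K (q a) (i a) (z a) ≠ jump K (q' a) (i a) (z a)} := by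
  have h : {a | jump K (q a) (i a) (z a) ≠ jump K (q' a) (i a) (z a)} =
      ⋃ k, i ⁻¹' {k} ∩ {a | jump K (q a) k (z a) = jump K (q' a) k (z a)}ᶜ := by
    ext a
    simp
  rw [h]
  exact MeasurableSet.iUnion fun k => (hi (measurableSet_singleton k)).inter
    (measurableSet_eq_fun (measurable_jump K hq hz k) (measurable_jump K hq' hz k)).compl

end

end HybridSwitching

namespace HybridSwitching

noncomputable section

/-! ### Approximation of time points from the left and from the right -/

/-- The largest point of the grid `ℕ / (k + 1)` strictly below `s` (or `0` if `s = 0`). -/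
def leftGrid (k : ℕ) (s : ℝ≥0) : ℝ≥0 := ((⌈((k : ℝ≥0) + 1) * s⌉₊ - 1 : ℕ) : ℝ≥0) / ((k : ℝ≥0) + 1)

/-- The smallest point of the grid `ℕ / (k + 1)` strictly above `s`. -/
def rightGrid (k : ℕ) (s : ℝ≥0) : ℝ≥0 := ((⌊((k : ℝ≥0) + 1) * s⌋₊ + 1 : ℕ) : ℝ≥0) / ((k : ℝ≥0) + 1)

theorem leftGrid_zero (k : ℕ) : leftGrid k 0 = 0 := by
  simp [leftGrid]

theorem leftGrid_lt (k : ℕ) {s : ℝ≥0} (hs : 0 < s) : leftGrid k s < s := by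
  rw [leftGrid, div_lt_iff₀ (by positivity), mul_comm s, ← Nat.lt_ceil]
  have : 0 < ⌈((k : ℝ≥0) + 1) * s⌉₊ := Nat.ceil_pos.2 (by positivity)
  omega

theorem le_leftGrid_add (k : ℕ) (s : ℝ≥0) : s ≤ leftGrid k s + 1 / ((k : ℝ≥0) + 1) := by
  rw [leftGrid, ← add_div, le_div_iff₀ (by positivity), mul_comm]
  refine (Nat.le_ceil _).trans ?_
  -- The subtraction is truncated at `s = 0`, where the inequality still holds.
  have : ⌈((k : ℝ≥0) + 1) * s⌉₊ ≤ ⌈((k : ℝ≥0) + 1) * s⌉₊ - 1 + 1 := by omega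
  exact_mod_cast this

theorem lt_rightGrid (k : ℕ) (s : ℝ≥0) : s < rightGrid k s := by
  rw [rightGrid, lt_div_iff₀ (by positivity), mul_comm]
  exact_mod_cast Nat.lt_floor_add_one _

theorem rightGrid_le_add (k : ℕ) (s : ℝ≥0) : rightGrid k s ≤ s + 1 / ((k : ℝ≥0) + 1) := by
  have h : (s + 1 / ((k : ℝ≥0) + 1)) * ((k : ℝ≥0) + 1) = ((k : ℝ≥0) + 1) * s + 1 := by
    field_simp
  rw [rightGrid, div_le_iff₀ (by positivity), h, Nat.cast_add, Nat.cast_one]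
  gcongr
  exact Nat.floor_le (by positivity)

theorem tendsto_one_div_add_one_nnreal :
    Tendsto (fun k : ℕ => 1 / ((k : ℝ≥0) + 1)) atTop (𝓝 0) := by
  rw [← NNReal.tendsto_coe]
  refine (tendsto_one_div_add_atTop_nhds_zero_nat (𝕜 := ℝ)).congr fun n => ?_
  push_cast
  rfl

theorem tendsto_leftGrid {s : ℝ≥0} (hs : 0 < s) :
    Tendsto (fun k => leftGrid k s) atTop (𝓝[<] s) := by
  refine tendsto_nhdsWithin_iff.2 ⟨?_, Eventually.of_forall fun k => leftGrid_lt k hs⟩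
  have h : Tendsto (fun k : ℕ => s - 1 / ((k : ℝ≥0) + 1)) atTop (𝓝 (s - 0)) :=
    tendsto_const_nhds.sub tendsto_one_div_add_one_nnreal
  rw [tsub_zero] at h
  exact tendsto_of_tendsto_of_tendsto_of_le_of_le h tendsto_const_nhds
    (fun k => tsub_le_iff_right.2 (le_leftGrid_add k s)) (fun k => (leftGrid_lt k hs).le)

theorem tendsto_rightGrid (s : ℝ≥0) :
    Tendsto (fun k => rightGrid k s) atTop (𝓝[≥] s) := by
  refine tendsto_nhdsWithin_iff.2 ⟨?_, Eventually.of_forall fun k => (lt_rightGrid k s).le⟩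
  have h : Tendsto (fun k : ℕ => s + 1 / ((k : ℝ≥0) + 1)) atTop (𝓝 (s + 0)) :=
    tendsto_const_nhds.add tendsto_one_div_add_one_nnreal
  rw [add_zero] at h
  exact tendsto_of_tendsto_of_tendsto_of_le_of_le tendsto_const_nhds h
    (fun k => (lt_rightGrid k s).le) (fun k => rightGrid_le_add k s)

variable {Ω : Type*} [mΩ : MeasurableSpace Ω]

/-- Sampling at `rightGrid k` uses countably many times, hence is jointly measurable; right
continuity recovers the process in the limit. -/
theorem measurable_uncurry_of_rightContinuous {β : Type*} [TopologicalSpace β]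
    [TopologicalSpace.PseudoMetrizableSpace β] [MeasurableSpace β] [BorelSpace β]
    {Y : ℝ≥0 → Ω → β} (hY : ∀ t, Measurable (Y t))
    (hcont : ∀ ω t, ContinuousWithinAt (fun s => Y s ω) (Set.Ici t) t) :
    Measurable fun p : Ω × ℝ≥0 => Y p.2 p.1 := by
  refine measurable_of_tendsto_metrizable (f := fun k p => Y (rightGrid k p.2) p.1) (fun k => ?_)
    (tendsto_pi_nhds.2 fun p => ?_)
  swap
  · have h : Tendsto (fun s => Y s p.1) (𝓝[≥] p.2) (𝓝 (Y p.2 p.1)) := hcont p.1 p.2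
    exact h.comp (tendsto_rightGrid p.2)
  have h1 : ∀ g : ℕ → ℝ≥0, Measurable fun p : Ω × ℕ => Y (g p.2) p.1 :=
    fun g => measurable_from_prod_countable_left fun n => hY (g n)
  have h2 : Measurable fun s : ℝ≥0 => ⌊((k : ℝ≥0) + 1) * s⌋₊ :=
    Nat.measurable_floor.comp (measurable_id.const_mul _)
  exact (h1 fun n => ((n + 1 : ℕ) : ℝ≥0) / ((k : ℝ≥0) + 1)).comp
    (measurable_fst.prodMk (h2.comp measurable_snd))

/-! ### Predictable sets -/

/-- The rectangles `G ×ˢ E` with `G ∈ F s` and all positive times in `E` later than `s`. -/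
def predictableRectangles (F : Filtration ℝ≥0 mΩ) : Set (Set (Ω × (ℝ≥0 × ℝ))) :=
  {A | ∃ (s : ℝ≥0) (G : Set Ω) (E : Set (ℝ≥0 × ℝ)), MeasurableSet[F s] G ∧ MeasurableSet E ∧
    (∀ p ∈ E, 0 < p.1 → s < p.1) ∧ A = G ×ˢ E}

/-- The product of the predictable `σ`-algebra and the Borel `σ`-algebra of the mark space. -/
@[reducible] def predictableSpace (F : Filtration ℝ≥0 mΩ) : MeasurableSpace (Ω × (ℝ≥0 × ℝ)) :=
  MeasurableSpace.generateFrom (predictableRectangles F)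

theorem isPiSystem_predictableRectangles (F : Filtration ℝ≥0 mΩ) :
    IsPiSystem (predictableRectangles F) := by
  rintro _ ⟨s, G, E, hG, hE, hs, rfl⟩ _ ⟨s', G', E', hG', hE', hs', rfl⟩ -
  refine ⟨max s s', G ∩ G', E ∩ E', ?_, hE.inter hE', ?_, Set.prod_inter_prod⟩
  · exact (F.mono (le_max_left s s') _ hG).inter (F.mono (le_max_right s s') _ hG')
  · exact fun p hp h0 => max_lt (hs p hp.1 h0) (hs' p hp.2 h0)

theorem predictableSpace_le (F : Filtration ℝ≥0 mΩ) :
    predictableSpace F ≤ (inferInstance : MeasurableSpace (Ω × (ℝ≥0 × ℝ))) := by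
  refine MeasurableSpace.generateFrom_le ?_
  rintro _ ⟨s, G, E, hG, hE, -, rfl⟩
  exact (F.le s _ hG).prod hE

theorem measurable_predictable_snd (F : Filtration ℝ≥0 mΩ) :
    Measurable[predictableSpace F] (Prod.snd : Ω × (ℝ≥0 × ℝ) → ℝ≥0 × ℝ) := by
  intro E hE
  refine MeasurableSpace.measurableSet_generateFrom
    ⟨0, Set.univ, E, MeasurableSet.univ, hE, fun p _ h => h, ?_⟩
  ext
  simp

/-- Sampling at `leftGrid k` looks strictly into the past: where the sampled time is `u`, every
positive current time exceeds `u`, so the level sets are predictable rectangles. The samples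
converge to the left limit. Time `0` has no past and is matched by `h0`. -/
theorem measurable_predictable_of_tendsto {β : Type*} [TopologicalSpace β]
    [TopologicalSpace.PseudoMetrizableSpace β] [MeasurableSpace β] [BorelSpace β]
    {F : Filtration ℝ≥0 mΩ} {Y Y' : ℝ≥0 → Ω → β} (hY : Adapted F Y) (h0 : ∀ ω, Y' 0 ω = Y 0 ω)
    (hlim : ∀ ω s, 0 < s → Tendsto (fun u => Y u ω) (𝓝[<] s) (𝓝 (Y' s ω))) :
    Measurable[predictableSpace F] fun p : Ω × (ℝ≥0 × ℝ) => Y' p.2.1 p.1 := by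
  refine @measurable_of_tendsto_metrizable _ _ (predictableSpace F) _ _ _ _
    (fun k p => Y (leftGrid k p.2.1) p.1) _ (fun k => ?_) (tendsto_pi_nhds.2 fun p => ?_)
  · intro A hA
    have h : (fun p : Ω × (ℝ≥0 × ℝ) => Y (leftGrid k p.2.1) p.1) ⁻¹' A =
        ⋃ n : ℕ, (Y ((n : ℝ≥0) / ((k : ℝ≥0) + 1)) ⁻¹' A) ×ˢ
          {p : ℝ≥0 × ℝ | ⌈((k : ℝ≥0) + 1) * p.1⌉₊ - 1 = n} := by
      ext p
      simp [leftGrid]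
    rw [h]
    refine @MeasurableSet.iUnion _ _ (predictableSpace F) _ _ fun n =>
      MeasurableSpace.measurableSet_generateFrom ⟨_, _, _, hY _ hA, ?_, ?_, rfl⟩
    · have : Measurable fun p : ℝ≥0 × ℝ => ⌈((k : ℝ≥0) + 1) * p.1⌉₊ - 1 :=
        (measurable_from_top (f := fun n : ℕ => n - 1)).comp
          (Nat.measurable_ceil.comp (measurable_fst.const_mul _))
      exact this (measurableSet_singleton n)
    · rintro p rfl hp
      exact leftGrid_lt k hp
  · rcases eq_or_lt_of_le (zero_le (a := p.2.1)) with h | h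
    · rw [← h]
      simp only [leftGrid_zero, h0]
      exact tendsto_const_nhds
    · exact (hlim p.1 p.2.1 h).comp (tendsto_leftGrid h)

/-! ### The compensator of a Poisson random measure -/

theorem lintegral_natCast_poissonMeasure (r : ℝ≥0) :
    ∫⁻ n : ℕ, (n : ℝ≥0∞) ∂(poissonMeasure r) = r := by
  have hs : HasSum (fun n : ℕ => Real.exp (-r) * (r : ℝ) ^ n / (n.factorial : ℝ) * n) r := by
    -- Shifting the index turns `n * rⁿ / n!` into `r` times the Poisson weights, which sum to one.
    rw [← hasSum_nat_add_iff' 1]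
    have h := (hasSum_one_poissonMeasure r).mul_left (r : ℝ)
    simp only [mul_one] at h
    simp only [Finset.range_one, Finset.sum_singleton, Nat.cast_zero, mul_zero, sub_zero]
    refine h.congr_fun fun n => ?_
    rw [Nat.factorial_succ]
    have : (n.factorial : ℝ) ≠ 0 := by positivity
    push_cast
    field_simp
    ring
  rw [lintegral_countable']
  have h : ∀ n : ℕ, (n : ℝ≥0∞) * poissonMeasure r {n} =
      ENNReal.ofReal (Real.exp (-r) * (r : ℝ) ^ n / (n.factorial : ℝ) * n) := by
    intro n
    rw [poissonMeasure_singleton, mul_comm, ENNReal.ofReal_mul (by positivity),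
      ENNReal.ofReal_natCast]
  simp_rw [h]
  rw [← ENNReal.ofReal_tsum_of_nonneg (fun n => by positivity) hs.summable, hs.tsum_eq,
    ENNReal.ofReal_coe_nnreal]

/-- The intensity measure `dt × dz` on `[0, ∞) × [0, κ]`. -/
def intensity (κ : ℝ) : Measure (ℝ≥0 × ℝ) :=
  timeMeasure.prod ((volume : Measure ℝ).restrict (Set.Icc 0 κ))

theorem lintegral_indicator_mul_of_indep {α : Type*} {m₁ m₂ m : MeasurableSpace α}
    {μ : Measure α} (h₁ : m₁ ≤ m) (h₂ : m₂ ≤ m) (hind : Indep m₂ m₁ μ) {G : Set α}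
    (hG : MeasurableSet[m₁] G) {f : α → ℝ≥0∞} (hf : Measurable[m₂] f) :
    ∫⁻ a, G.indicator 1 a * f a ∂μ = μ G * ∫⁻ a, f a ∂μ := by
  have hi : Measurable[m₁] (G.indicator (1 : α → ℝ≥0∞)) :=
    Measurable.indicator measurable_const hG
  rw [lintegral_mul_eq_lintegral_mul_lintegral_of_independent_measurableSpace h₁ h₂ hind.symm
    hi hf, lintegral_indicator_one (h₁ _ hG)]

namespace IsFPoisson

variable {P : Measure Ω} {F : Filtration ℝ≥0 mΩ} {κ : ℝ} {M : Ω → Measure (ℝ≥0 × ℝ)}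

theorem lintegral_apply (hM : IsFPoisson P F κ M) {A : Set (ℝ≥0 × ℝ)} (hA : MeasurableSet A)
    (hfin : intensity κ A ≠ ∞) : ∫⁻ ω, M ω A ∂P = intensity κ A := by
  have h := (hM.law A hA hfin).lintegral_comp (f := fun x => x) aemeasurable_id'
  rw [h, lintegral_map measurable_id' (measurable_of_countable _),
    lintegral_natCast_poissonMeasure]
  exact ENNReal.coe_toNNReal hfin

theorem ae_apply_zero_time (hM : IsFPoisson P F κ M) :
    ∀ᵐ ω ∂P, M ω ({0} ×ˢ Set.univ) = 0 := by
  have hA : MeasurableSet (({0} : Set ℝ≥0) ×ˢ (Set.univ : Set ℝ)) :=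
    (measurableSet_singleton 0).prod MeasurableSet.univ
  have h0 : intensity κ ({0} ×ˢ Set.univ) = 0 := by
    rw [intensity, Measure.prod_prod, timeMeasure_singleton_zero, zero_mul]
  have h := hM.lintegral_apply hA (by simp [h0])
  rw [h0, lintegral_eq_zero_iff (hM.measurable _ hA)] at h
  exact h

theorem lintegral_indicator_mul (hM : IsFPoisson P F κ M) {s : ℝ≥0} {G : Set Ω}
    (hG : MeasurableSet[F s] G) {A : Set (ℝ≥0 × ℝ)} (hA : MeasurableSet A)
    (hs : A ⊆ Set.Ioi s ×ˢ Set.univ) (hfin : intensity κ A ≠ ∞) :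
    ∫⁻ ω, G.indicator 1 ω * M ω A ∂P = P G * intensity κ A := by
  rw [lintegral_indicator_mul_of_indep (F.le s)
    (iSup₂_le fun A hA => (hM.measurable A hA.1).comap_le) (hM.indep_future s) hG,
    hM.lintegral_apply hA hfin]
  exact Measurable.mono (comap_measurable _)
    (le_iSup₂ (f := fun (A : Set (ℝ≥0 × ℝ))
      (_ : MeasurableSet A ∧ A ⊆ Set.Ioi s ×ˢ Set.univ) =>
        MeasurableSpace.comap (fun ω => M ω A) inferInstance) A ⟨hA, hs⟩) le_rfl

/-- A π-λ argument. On a rectangle `G ×ˢ E` with `G ∈ F s`, the points of `E` at positive times lie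
after `s`, so their number is independent of `G` and the expectation factorizes. Excluding time `0`
is essential here. -/
theorem lintegral_predictable [IsProbabilityMeasure P] (hM : IsFPoisson P F κ M) (t : ℝ≥0)
    {A : Set (Ω × (ℝ≥0 × ℝ))} (hA : MeasurableSet[predictableSpace F] A) :
    AEMeasurable (fun ω => M ω (Prod.mk ω ⁻¹' A ∩ Set.Ioc 0 t ×ˢ Set.Icc 0 κ)) P ∧
      ∫⁻ ω, M ω (Prod.mk ω ⁻¹' A ∩ Set.Ioc 0 t ×ˢ Set.Icc 0 κ) ∂P =
        ∫⁻ ω, intensity κ (Prod.mk ω ⁻¹' A ∩ Set.Ioc 0 t ×ˢ Set.Icc 0 κ) ∂P := by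
  -- Finite intensity of `S` permits subtraction in the complement step. Since `M ω S` is finite
  -- only almost surely, measurability is carried along as `AEMeasurable`.
  set S : Set (ℝ≥0 × ℝ) := Set.Ioc 0 t ×ˢ Set.Icc 0 κ with hS
  have hSm : MeasurableSet S := measurableSet_Ioc.prod measurableSet_Icc
  have hSfin : intensity κ S < ∞ := by
    rw [intensity, hS, Measure.prod_prod]
    refine ENNReal.mul_lt_top ?_ ?_
    · exact (measure_mono Set.Ioc_subset_Iic_self).trans_lt (by simp [timeMeasure_Iic])
    · rw [Measure.restrict_apply_self, Real.volume_Icc]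
      exact ENNReal.ofReal_lt_top
  have hMS : ∀ᵐ ω ∂P, M ω S < ∞ := by
    refine ae_lt_top (hM.measurable _ hSm) ?_
    rw [hM.lintegral_apply hSm hSfin.ne]
    exact hSfin.ne
  have hsec : ∀ {A : Set (Ω × (ℝ≥0 × ℝ))}, MeasurableSet[predictableSpace F] A → ∀ ω,
      MeasurableSet (Prod.mk ω ⁻¹' A) := fun hA ω =>
    measurable_prodMk_left (predictableSpace_le F _ hA)
  have hint : ∀ {A : Set (Ω × (ℝ≥0 × ℝ))}, MeasurableSet[predictableSpace F] A →
      Measurable fun ω => intensity κ (Prod.mk ω ⁻¹' A ∩ S) := by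
    intro A hA
    have : SFinite (intensity κ) := by unfold intensity; infer_instance
    have h := measurable_measure_prodMk_left (ν := (intensity κ).restrict S)
      (predictableSpace_le F _ hA)
    simpa only [Measure.restrict_apply (hsec hA _)] using h
  refine MeasurableSpace.induction_on_inter (m := predictableSpace F)
    (C := fun A _ => AEMeasurable (fun ω => M ω (Prod.mk ω ⁻¹' A ∩ S)) P ∧
      ∫⁻ ω, M ω (Prod.mk ω ⁻¹' A ∩ S) ∂P = ∫⁻ ω, intensity κ (Prod.mk ω ⁻¹' A ∩ S) ∂P)
    rfl (isPiSystem_predictableRectangles F) ?_ ?_ ?_ ?_ A hA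
  · simp
  · rintro _ ⟨s, G, E, hG, hE, hs, rfl⟩
    have hprod : ∀ (ν : Measure (ℝ≥0 × ℝ)) ω, ν (Prod.mk ω ⁻¹' (G ×ˢ E) ∩ S) =
        G.indicator 1 ω * ν (E ∩ S) := by
      intro ν ω
      by_cases hω : ω ∈ G <;> simp [hω]
    have hES : MeasurableSet (E ∩ S) := hE.inter hSm
    simp only [hprod]
    refine ⟨((measurable_one.indicator (F.le s _ hG)).mul (hM.measurable _ hES)).aemeasurable, ?_⟩
    rw [hM.lintegral_indicator_mul hG hES, lintegral_mul_const _
      (measurable_one.indicator (F.le s _ hG)), lintegral_indicator_one (F.le s _ hG)]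
    · exact fun p hp => ⟨hs p hp.1 hp.2.1.1, Set.mem_univ _⟩
    · exact ((measure_mono Set.inter_subset_right).trans_lt hSfin).ne
  · rintro A hA ⟨h1, h2⟩
    have hcompl : ∀ (ν : Measure (ℝ≥0 × ℝ)) ω, ν S < ∞ → ν (Prod.mk ω ⁻¹' Aᶜ ∩ S) =
        ν S - ν (Prod.mk ω ⁻¹' A ∩ S) := by
      intro ν ω hν
      rw [← measure_sdiff Set.inter_subset_right ((hsec hA ω).inter hSm).nullMeasurableSet
        ((measure_mono Set.inter_subset_right).trans_lt hν).ne]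
      congr 1
      ext p
      simp
      tauto
    have hae : (fun ω => M ω (Prod.mk ω ⁻¹' Aᶜ ∩ S)) =ᵐ[P]
        fun ω => M ω S - M ω (Prod.mk ω ⁻¹' A ∩ S) := by
      filter_upwards [hMS] with ω hω using hcompl _ _ hω
    have hle : ∫⁻ ω, intensity κ (Prod.mk ω ⁻¹' A ∩ S) ∂P ≠ ∞ := by
      refine ne_top_of_le_ne_top (b := ∫⁻ _, intensity κ S ∂P) (by simpa using hSfin.ne) ?_
      exact lintegral_mono fun ω => measure_mono Set.inter_subset_right
    refine ⟨((hM.measurable _ hSm).aemeasurable.sub h1).congr hae.symm, ?_⟩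
    rw [lintegral_congr_ae hae, lintegral_sub' h1 (h2 ▸ hle)
      (Eventually.of_forall fun ω => measure_mono Set.inter_subset_right), h2,
      hM.lintegral_apply hSm hSfin.ne]
    simp only [hcompl (intensity κ) _ hSfin]
    rw [lintegral_sub (hint hA) hle
      (Eventually.of_forall fun ω => measure_mono Set.inter_subset_right)]
    simp
  · intro f hf hfm hfi
    have hun : ∀ (ν : Measure (ℝ≥0 × ℝ)) ω, ν (Prod.mk ω ⁻¹' (⋃ n, f n) ∩ S) =
        ∑' n, ν (Prod.mk ω ⁻¹' (f n) ∩ S) := by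
      intro ν ω
      rw [Set.preimage_iUnion, Set.iUnion_inter, measure_iUnion]
      · exact fun i j hij => ((hf hij).preimage _).mono Set.inter_subset_left Set.inter_subset_left
      · exact fun n => (hsec (hfm n) ω).inter hSm
    simp only [hun]
    refine ⟨AEMeasurable.tsum fun n => (hfi n).1, ?_⟩
    rw [lintegral_tsum fun n => (hfi n).1, lintegral_tsum fun n => (hint (hfm n)).aemeasurable]
    exact tsum_congr fun n => (hfi n).2

end IsFPoisson

end

end HybridSwitching

namespace HybridSwitching

noncomputable section

/-! ### Measurability and perturbation of the rates -/

theorem measurable_sum_indicator_apply {α : Type*} [MeasurableSpace α] {N : ℕ} {ι : Type*}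
    (s : Finset ι) {S : ι → Set α} (hS : ∀ k, MeasurableSet (S k))
    (q : ι → Matrix (Fin N) (Fin N) ℝ) (i j : Fin N) :
    Measurable fun x => (∑ k ∈ s, (S k).indicator (fun _ => q k) x) i j := by
  have h : ∀ x, (∑ k ∈ s, (S k).indicator (fun _ => q k) x) i j =
      ∑ k ∈ s, (S k).indicator (fun _ => q k i j) x := by
    intro x
    rw [Matrix.sum_apply]
    refine Finset.sum_congr rfl fun k _ => ?_
    by_cases hx : x ∈ S k <;> simp [hx]
  simp only [h]
  exact Finset.measurable_sum _ fun k _ => measurable_const.indicator (hS k)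

theorem IsRadialThreshold.measurable_apply {d N : ℕ}
    {Q : EuclideanSpace ℝ (Fin d) → Matrix (Fin N) (Fin N) ℝ} (hQ : IsRadialThreshold Q)
    (i j : Fin N) : Measurable fun x => Q x i j := by
  obtain ⟨m, α, q, -, -, -, -, h⟩ := hQ
  simp only [h]
  exact measurable_sum_indicator_apply _
    (fun k => measurableSet_Ico.preimage (measurable_norm.coe_real_ereal)) q i j

theorem IsLineThreshold.measurable_apply {d N : ℕ}
    {Q : EuclideanSpace ℝ (Fin d) → Matrix (Fin N) (Fin N) ℝ} (hQ : IsLineThreshold Q)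
    (i j : Fin N) : Measurable fun x => Q x i j := by
  obtain ⟨hd, m, α, q₀, q, -, -, -, -, -, h⟩ := hQ
  have hcoord : Measurable fun y : EuclideanSpace ℝ (Fin d) =>
      ((y (Fin.cast hd.symm 0) : ℝ) : EReal) := by fun_prop
  simp only [h, Matrix.add_apply]
  refine Measurable.add ?_ (measurable_sum_indicator_apply _
    (fun k => measurableSet_Ico.preimage hcoord) q i j)
  have h₀ : Measurable fun x => (((fun y : EuclideanSpace ℝ (Fin d) =>
      ((y (Fin.cast hd.symm 0) : ℝ) : EReal)) ⁻¹' Set.Iio (α 0)).indicator (fun _ => q₀) x) i j := by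
    simpa using measurable_sum_indicator_apply {()}
      (fun _ => measurableSet_Iio.preimage hcoord) (fun _ => q₀) i j
  exact h₀

theorem measurable_apply_of_lipschitz {d N : ℕ} {K : ℝ}
    {Q : EuclideanSpace ℝ (Fin d) → Matrix (Fin N) (Fin N) ℝ}
    (hQ : ∀ x y i j, |Q x i j - Q y i j| ≤ K * ‖x - y‖) (i j : Fin N) :
    Measurable fun x => Q x i j := by
  refine (LipschitzWith.of_dist_le_mul (K := K.toNNReal) fun x y => ?_).continuous.measurable
  rw [Real.dist_eq, dist_eq_norm]
  exact (hQ x y i j).trans (by gcongr; exact Real.le_coe_toNNReal K)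

/-- The comparison passes through `Q y`, so only `Q` has to be Lipschitz; the discontinuous `Q'`
enters through `rateGap`. The factor `N - 1` counts the off-diagonal entries of a row. -/
theorem volume_jump_ne_le_rateGap {d N : ℕ} (K : ℝ) {K₃ : ℝ} (hK₃ : 0 ≤ K₃)
    {Q Q' : EuclideanSpace ℝ (Fin d) → Matrix (Fin N) (Fin N) ℝ}
    (hQ : ∀ x y i j, |Q x i j - Q y i j| ≤ K₃ * ‖x - y‖)
    (x y : EuclideanSpace ℝ (Fin d)) (i : Fin N) :
    volume {z | jump K (Q x) i z ≠ jump K (Q' y) i z} ≤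
      rateGap Q' Q + ENNReal.ofReal (((N : ℝ) - 1) * K₃) * ‖x - y‖ₑ := by
  refine (volume_jump_ne_le K i).trans ?_
  have hterm : ∀ j, ENNReal.ofReal |Q x i j - Q' y i j| ≤
      ENNReal.ofReal |Q' y i j - Q y i j| + ENNReal.ofReal K₃ * ‖x - y‖ₑ := by
    intro j
    rw [← ofReal_norm, ← ENNReal.ofReal_mul hK₃,
      ← ENNReal.ofReal_add (abs_nonneg _) (by positivity)]
    refine ENNReal.ofReal_le_ofReal ?_
    calc |Q x i j - Q' y i j| = |-(Q' y i j - Q y i j) + (Q x i j - Q y i j)| := by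
          congr 1
          ring
      _ ≤ |Q' y i j - Q y i j| + |Q x i j - Q y i j| := by
          refine (abs_add_le _ _).trans ?_
          rw [abs_neg]
      _ ≤ _ := by
          gcongr
          exact hQ x y i j
  refine (Finset.sum_le_sum fun j _ => hterm j).trans ?_
  rw [Finset.sum_add_distrib]
  gcongr
  · exact le_iSup₂ (f := fun x i => ∑ j ∈ Finset.univ.erase i,
      ENNReal.ofReal |Q' x i j - Q x i j|) y i
  · have hN : 1 ≤ N := Fin.pos i
    rw [Finset.sum_const, Finset.card_erase_of_mem (Finset.mem_univ i), Finset.card_univ,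
      Fintype.card_fin, nsmul_eq_mul, ENNReal.ofReal_mul (by simpa using hN), mul_assoc,
      ← ENNReal.ofReal_natCast, Nat.cast_sub hN, Nat.cast_one]

/-! ### Decoupling of two switching processes -/

theorem leftLim_eq_of_eqOn {β : Type*} [TopologicalSpace β] [T2Space β] {f g : ℝ≥0 → β}
    {s : ℝ≥0} (hs : 0 < s) (hfg : ∀ u < s, f u = g u) (hf : ∃ y, Tendsto f (𝓝[<] s) (𝓝 y)) :
    Function.leftLim f s = Function.leftLim g s := by
  obtain ⟨y, hy⟩ := hf
  have : (𝓝[<] s).NeBot := nhdsLT_neBot_of_exists_lt ⟨0, hs⟩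
  have hg : Tendsto g (𝓝[<] s) (𝓝 y) :=
    hy.congr' (eventually_nhdsWithin_of_forall fun u hu => hfg u hu)
  rw [leftLim_eq_of_tendsto hy, leftLim_eq_of_tendsto hg]

/-- If two switching paths driven by the same point measure differ at time `t`, then a point with
different jump sizes has occurred before. -/
theorem measure_jump_ne_ne_zero {N : ℕ} {K κ : ℝ} {m : Measure (ℝ≥0 × ℝ)}
    (hm : m ({0} ×ˢ Set.univ) = 0) {q q' : ℝ≥0 → Matrix (Fin N) (Fin N) ℝ} {l l' : ℝ≥0 → Fin N}
    (hl : ∀ t, ContinuousWithinAt l (Set.Ici t) t)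
    (hl' : ∀ t, ContinuousWithinAt l' (Set.Ici t) t)
    (hlim : ∀ t, ∃ i, Tendsto l (𝓝[<] t) (𝓝 i)) {c : ℝ}
    (heq : ∀ t : ℝ≥0, ((l t : ℕ) : ℝ) = c + ∫ p in Set.Iic t ×ˢ Set.Icc 0 κ,
      jump K (q p.1) (Function.leftLim l p.1) p.2 ∂m)
    (heq' : ∀ t : ℝ≥0, ((l' t : ℕ) : ℝ) = c + ∫ p in Set.Iic t ×ˢ Set.Icc 0 κ,
      jump K (q' p.1) (Function.leftLim l' p.1) p.2 ∂m) {t : ℝ≥0} (hne : l t ≠ l' t) :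
    m ({p | jump K (q p.1) (Function.leftLim l p.1) p.2 ≠
      jump K (q' p.1) (Function.leftLim l p.1) p.2} ∩ Set.Ioc 0 t ×ˢ Set.Icc 0 κ) ≠ 0 := by
  intro hnull
  set D : Set ℝ≥0 := {s | l s ≠ l' s} with hD
  set τ : ℝ≥0 := sInf D
  have htD : t ∈ D := hne
  have hτt : τ ≤ t := csInf_le' htD
  have hbefore : ∀ s < τ, l s = l' s := fun s hs => by
    by_contra h
    exact (csInf_le' (show s ∈ D from h)).not_gt hs
  -- The states are discrete, so right-continuous paths are constant just after `τ`; agreement at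
  -- `τ` would persist there and contradict the choice of the infimum.
  have hτ : l τ ≠ l' τ := by
    intro h
    have h1 : ∀ᶠ s in 𝓝[≥] τ, l s = l τ := hl τ (mem_nhds_discrete.2 (Set.mem_singleton _))
    have h2 : ∀ᶠ s in 𝓝[≥] τ, l' s = l' τ := hl' τ (mem_nhds_discrete.2 (Set.mem_singleton _))
    obtain ⟨s, hs, h3, h4⟩ := (((isGLB_csInf ⟨t, htD⟩ (OrderBot.bddBelow D)).frequently_mem
      ⟨t, htD⟩).and_eventually (h1.and h2)).exists
    exact hs (by rw [h3, h4, h])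
  apply hτ
  apply Fin.ext
  -- The paths agree before `τ`, hence their left limits agree on `(0, τ]`. Without a disagreeing
  -- point the integrands coincide almost everywhere, which forces agreement at `τ`; time `0` is
  -- excluded by `hm`.
  have hint : ∫ p in Set.Iic τ ×ˢ Set.Icc 0 κ,
        jump K (q p.1) (Function.leftLim l p.1) p.2 ∂m =
      ∫ p in Set.Iic τ ×ˢ Set.Icc 0 κ, jump K (q' p.1) (Function.leftLim l' p.1) p.2 ∂m := by
    refine integral_congr_ae ?_
    have hS : MeasurableSet (Set.Iic τ ×ˢ Set.Icc 0 κ) := measurableSet_Iic.prod measurableSet_Icc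
    refine (ae_restrict_iff' hS).2 ?_
    filter_upwards [compl_mem_ae_iff.2 hnull, compl_mem_ae_iff.2 hm] with p h1 h2 hp
    have hp0 : 0 < p.1 := by
      refine pos_iff_ne_zero.2 fun h => h2 ⟨h, Set.mem_univ _⟩
    have hp1 : p.1 ≤ τ := hp.1
    rw [← leftLim_eq_of_eqOn hp0 (fun u hu => hbefore u (hu.trans_le hp1)) (hlim _)]
    by_contra h
    exact h1 ⟨h, ⟨hp0, hp1.trans hτt⟩, hp.2⟩
  have : ((l τ : ℕ) : ℝ) = ((l' τ : ℕ) : ℝ) := by rw [heq, heq', hint]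
  exact_mod_cast this

/-! ### Two hybrid systems with the same noise -/

variable {Ω : Type*} [mΩ : MeasurableSpace Ω] {P : Measure Ω} {F : Filtration ℝ≥0 mΩ} {d N : ℕ}
  {B : ℝ≥0 → Ω → EuclideanSpace ℝ (Fin d)} {κ : ℝ} {M : Ω → Measure (ℝ≥0 × ℝ)}
  {b : EuclideanSpace ℝ (Fin d) → Fin N → EuclideanSpace ℝ (Fin d)}
  {σ : Matrix (Fin d) (Fin d) ℝ} {K : ℝ}
  {Q Q' : EuclideanSpace ℝ (Fin d) → Matrix (Fin N) (Fin N) ℝ}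
  {x₀ : EuclideanSpace ℝ (Fin d)} {i₀ : Fin N}
  {X X' : ℝ≥0 → Ω → EuclideanSpace ℝ (Fin d)} {Λ Λ' : ℝ≥0 → Ω → Fin N}

namespace IsSolution

theorem measurable_fst (h : IsSolution P F B κ M b σ K Q x₀ i₀ X Λ) (t : ℝ≥0) :
    Measurable (X t) := (h.adapted_fst t).mono (F.le t) le_rfl

theorem measurable_uncurry_fst (h : IsSolution P F B κ M b σ K Q x₀ i₀ X Λ) :
    Measurable fun p : Ω × ℝ≥0 => X p.2 p.1 :=
  measurable_uncurry_of_rightContinuous h.measurable_fst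
    fun ω _ => (h.continuous_fst ω).continuousWithinAt

theorem measurable_uncurry_snd (h : IsSolution P F B κ M b σ K Q x₀ i₀ X Λ) :
    Measurable fun p : Ω × ℝ≥0 => Λ p.2 p.1 :=
  measurable_uncurry_of_rightContinuous (fun t => (h.adapted_snd t).mono (F.le t) le_rfl)
    h.right_cont_snd

theorem measurable_predictable_fst (h : IsSolution P F B κ M b σ K Q x₀ i₀ X Λ) :
    Measurable[predictableSpace F] fun p : Ω × (ℝ≥0 × ℝ) => X p.2.1 p.1 :=
  measurable_predictable_of_tendsto h.adapted_fst (fun _ => rfl)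
    fun ω s _ => ((h.continuous_fst ω).tendsto s).mono_left nhdsWithin_le_nhds

theorem measurable_predictable_leftLim (h : IsSolution P F B κ M b σ K Q x₀ i₀ X Λ) :
    Measurable[predictableSpace F] fun p : Ω × (ℝ≥0 × ℝ) =>
      Function.leftLim (fun s => Λ s p.1) p.2.1 := by
  refine measurable_predictable_of_tendsto
    (Y' := fun s ω => Function.leftLim (fun s => Λ s ω) s) h.adapted_snd (fun ω => ?_)
    fun ω s hs => ?_
  -- At time `0` the value of `leftLim` is the value of the path by convention.
  · exact leftLim_eq_of_isBot isBot_bot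
  · obtain ⟨i, hi⟩ := h.left_lim_snd ω s
    have : (𝓝[<] s).NeBot := nhdsLT_neBot_of_exists_lt ⟨0, hs⟩
    rwa [leftLim_eq_of_tendsto hi]

theorem measurableSet_jump_ne (h : IsSolution P F B κ M b σ K Q x₀ i₀ X Λ)
    (h' : IsSolution P F B κ M b σ K Q' x₀ i₀ X' Λ')
    (hQ : ∀ i j, Measurable fun x => Q x i j) (hQ' : ∀ i j, Measurable fun x => Q' x i j) :
    MeasurableSet[predictableSpace F] {p : Ω × (ℝ≥0 × ℝ) |
      jump K (Q (X p.2.1 p.1)) (Function.leftLim (fun s => Λ s p.1) p.2.1) p.2.2 ≠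
      jump K (Q' (X' p.2.1 p.1)) (Function.leftLim (fun s => Λ s p.1) p.2.1) p.2.2} :=
  HybridSwitching.measurableSet_jump_ne (m := predictableSpace F) K
    (q := fun p => Q (X p.2.1 p.1)) (q' := fun p => Q' (X' p.2.1 p.1))
    (fun i j => (hQ i j).comp h.measurable_predictable_fst)
    (fun i j => (hQ' i j).comp h'.measurable_predictable_fst)
    h.measurable_predictable_leftLim
    (measurable_snd.comp (measurable_predictable_snd F))

/-- The probability that the switching components differ. -/
theorem measure_snd_ne_le [IsProbabilityMeasure P] (hM : IsFPoisson P F κ M)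
    (h : IsSolution P F B κ M b σ K Q x₀ i₀ X Λ)
    (h' : IsSolution P F B κ M b σ K Q' x₀ i₀ X' Λ')
    {K₃ : ℝ} (hK₃ : 0 ≤ K₃) (hQ : ∀ x y i j, |Q x i j - Q y i j| ≤ K₃ * ‖x - y‖)
    (hQ' : ∀ i j, Measurable fun x => Q' x i j) (t : ℝ≥0) :
    P {ω | Λ t ω ≠ Λ' t ω} ≤ ∫⁻ s in Set.Iic t,
      (rateGap Q' Q + ENNReal.ofReal (((N : ℝ) - 1) * K₃) * ∫⁻ ω, ‖X s ω - X' s ω‖ₑ ∂P)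
        ∂timeMeasure := by
  have hH := h.measurableSet_jump_ne h' (measurable_apply_of_lipschitz hQ) hQ'
  set H : Set (Ω × (ℝ≥0 × ℝ)) := {p |
      jump K (Q (X p.2.1 p.1)) (Function.leftLim (fun s => Λ s p.1) p.2.1) p.2.2 ≠
      jump K (Q' (X' p.2.1 p.1)) (Function.leftLim (fun s => Λ s p.1) p.2.1) p.2.2} with hHdef
  have hHsec : ∀ ω, MeasurableSet (Prod.mk ω ⁻¹' H) := fun ω =>
    measurable_prodMk_left (predictableSpace_le F _ hH)
  have hS : MeasurableSet (Set.Ioc 0 t ×ˢ Set.Icc 0 κ) := measurableSet_Ioc.prod measurableSet_Icc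
  have hdiff : Measurable fun p : Ω × ℝ≥0 => ‖X p.2 p.1 - X' p.2 p.1‖ₑ :=
    (h.measurable_uncurry_fst.sub h'.measurable_uncurry_fst).enorm
  have hmeas : MeasurableSet {ω | Λ t ω ≠ Λ' t ω} :=
    (measurableSet_eq_fun ((h.adapted_snd t).mono (F.le t) le_rfl)
      ((h'.adapted_snd t).mono (F.le t) le_rfl)).compl
  have hind : ∀ᵐ ω ∂P, {ω | Λ t ω ≠ Λ' t ω}.indicator 1 ω ≤
      M ω (Prod.mk ω ⁻¹' H ∩ Set.Ioc 0 t ×ˢ Set.Icc 0 κ) := by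
    filter_upwards [h.eq_snd, h'.eq_snd, hM.ae_apply_zero_time] with ω h1 h2 h3
    by_cases hω : ω ∈ {ω | Λ t ω ≠ Λ' t ω}
    swap
    · rw [Set.indicator_of_notMem hω]
      exact zero_le
    rw [Set.indicator_of_mem hω, Pi.one_apply]
    have h4 : M ω (Prod.mk ω ⁻¹' H ∩ Set.Ioc 0 t ×ˢ Set.Icc 0 κ) ≠ 0 :=
      measure_jump_ne_ne_zero (l := fun s => Λ s ω) (l' := fun s => Λ' s ω)
        (q := fun s => Q (X s ω)) (q' := fun s => Q' (X' s ω)) h3 (h.right_cont_snd ω)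
        (h'.right_cont_snd ω) (h.left_lim_snd ω) h1 h2 hω
    -- The number of points is an integer, so being nonzero makes it at least `1` and it dominates
    -- the indicator.
    obtain ⟨n, hn⟩ := hM.integer_valued ω _ ((hHsec ω).inter hS)
    rw [hn] at h4 ⊢
    have h5 : n ≠ 0 := by
      rintro rfl
      exact h4 (by simp)
    have h6 : (1 : ℕ∞) ≤ n := Order.one_le_iff_ne_zero.2 h5
    exact_mod_cast h6
  have hint : ∀ ω, intensity κ (Prod.mk ω ⁻¹' H ∩ Set.Ioc 0 t ×ˢ Set.Icc 0 κ) ≤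
      ∫⁻ s in Set.Iic t, (rateGap Q' Q +
        ENNReal.ofReal (((N : ℝ) - 1) * K₃) * ‖X s ω - X' s ω‖ₑ) ∂timeMeasure := by
    intro ω
    rw [intensity, Measure.prod_apply ((hHsec ω).inter hS),
      ← lintegral_indicator measurableSet_Iic]
    refine lintegral_mono fun s => ?_
    by_cases hs : s ∈ Set.Iic t
    · rw [Set.indicator_of_mem hs]
      refine (Measure.restrict_apply_le _ _).trans ((measure_mono ?_).trans
        (volume_jump_ne_le_rateGap K hK₃ hQ (X s ω) (X' s ω)
          (Function.leftLim (fun s => Λ s ω) s)))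
      exact fun z hz => hz.1
    · rw [Set.indicator_of_notMem hs]
      have : Prod.mk s ⁻¹' (Prod.mk ω ⁻¹' H ∩ Set.Ioc 0 t ×ˢ Set.Icc 0 κ) = ∅ := by
        ext z
        simp only [Set.mem_preimage, Set.mem_inter_iff, Set.mem_prod, Set.mem_empty_iff_false,
          iff_false]
        exact fun hz => hs hz.2.1.2
      rw [this, measure_empty]
  calc P {ω | Λ t ω ≠ Λ' t ω} = ∫⁻ ω, {ω | Λ t ω ≠ Λ' t ω}.indicator 1 ω ∂P :=
        (lintegral_indicator_one hmeas).symm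
    _ ≤ ∫⁻ ω, M ω (Prod.mk ω ⁻¹' H ∩ Set.Ioc 0 t ×ˢ Set.Icc 0 κ) ∂P := lintegral_mono_ae hind
    _ = ∫⁻ ω, intensity κ (Prod.mk ω ⁻¹' H ∩ Set.Ioc 0 t ×ˢ Set.Icc 0 κ) ∂P :=
        (hM.lintegral_predictable t hH).2
    _ ≤ ∫⁻ ω, ∫⁻ s in Set.Iic t, (rateGap Q' Q +
        ENNReal.ofReal (((N : ℝ) - 1) * K₃) * ‖X s ω - X' s ω‖ₑ) ∂timeMeasure ∂P :=
        lintegral_mono hint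
    _ = ∫⁻ s in Set.Iic t, ∫⁻ ω, (rateGap Q' Q +
        ENNReal.ofReal (((N : ℝ) - 1) * K₃) * ‖X s ω - X' s ω‖ₑ) ∂P ∂timeMeasure :=
        lintegral_lintegral_swap ((hdiff.const_mul _).const_add _).aemeasurable
    _ = _ := by
        refine lintegral_congr fun s => ?_
        have hs : Measurable fun ω => ‖X s ω - X' s ω‖ₑ :=
          ((h.measurable_fst s).sub (h'.measurable_fst s)).enorm
        rw [lintegral_add_left measurable_const, lintegral_const_mul _ hs, lintegral_const,
          measure_univ, mul_one]

end IsSolution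

end

end HybridSwitching

/-! ### Drift estimate, Grönwall argument and Wasserstein bound -/

namespace HybridSwitching

noncomputable section

variable {Ω : Type*} [mΩ : MeasurableSpace Ω] {P : Measure Ω} {F : Filtration ℝ≥0 mΩ} {d N : ℕ}
  {B : ℝ≥0 → Ω → EuclideanSpace ℝ (Fin d)} {κ : ℝ} {M : Ω → Measure (ℝ≥0 × ℝ)}
  {b : EuclideanSpace ℝ (Fin d) → Fin N → EuclideanSpace ℝ (Fin d)}
  {σ : Matrix (Fin d) (Fin d) ℝ} {K : ℝ}
  {Q Q' : EuclideanSpace ℝ (Fin d) → Matrix (Fin N) (Fin N) ℝ}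
  {x₀ : EuclideanSpace ℝ (Fin d)} {i₀ : Fin N}
  {X X' : ℝ≥0 → Ω → EuclideanSpace ℝ (Fin d)} {Λ Λ' : ℝ≥0 → Ω → Fin N}

/-- The drift is the sum of a bounded part that depends on the regime and a common part, which are
jointly Lipschitz with constant `K₂`. -/
structure IsRegularDrift (b : EuclideanSpace ℝ (Fin d) → Fin N → EuclideanSpace ℝ (Fin d))
    (bhat : EuclideanSpace ℝ (Fin d) → Fin N → EuclideanSpace ℝ (Fin d))
    (Z : EuclideanSpace ℝ (Fin d) → EuclideanSpace ℝ (Fin d)) (K₂ : ℝ) : Prop where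
  pos : 0 < K₂
  eq_add : ∀ x i, b x i = bhat x i + Z x
  lipschitz : ∀ x y i, ‖bhat x i - bhat y i‖ + ‖Z x - Z y‖ ≤ K₂ * ‖x - y‖
  bounded : ∀ x i, ‖bhat x i‖ ≤ K₂

namespace IsRegularDrift

variable {bhat : EuclideanSpace ℝ (Fin d) → Fin N → EuclideanSpace ℝ (Fin d)}
  {Z : EuclideanSpace ℝ (Fin d) → EuclideanSpace ℝ (Fin d)} {K₂ : ℝ}

theorem continuous_bhat (h : IsRegularDrift b bhat Z K₂) (i : Fin N) :
    Continuous fun x => bhat x i := by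
  refine (LipschitzWith.of_dist_le_mul (K := K₂.toNNReal) fun x y => ?_).continuous
  rw [dist_eq_norm, dist_eq_norm, Real.coe_toNNReal _ h.pos.le]
  exact (le_add_of_nonneg_right (norm_nonneg _)).trans (h.lipschitz x y i)

/-- The state `i` is needed because the bound on `Z` is only available jointly with that on `bhat ·
i`. -/
theorem continuous_common (h : IsRegularDrift b bhat Z K₂) (i : Fin N) : Continuous Z := by
  refine (LipschitzWith.of_dist_le_mul (K := K₂.toNNReal) fun x y => ?_).continuous
  rw [dist_eq_norm, dist_eq_norm, Real.coe_toNNReal _ h.pos.le]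
  exact (le_add_of_nonneg_left (norm_nonneg _)).trans (h.lipschitz x y i)

theorem enorm_sub_le (h : IsRegularDrift b bhat Z K₂) (x y : EuclideanSpace ℝ (Fin d))
    (i j : Fin N) : ‖b x i - b y j‖ₑ ≤
      ENNReal.ofReal K₂ * ‖x - y‖ₑ + if i = j then 0 else ENNReal.ofReal (2 * K₂) := by
  have hK := h.pos.le
  rw [← ofReal_norm, ← ofReal_norm, ← ENNReal.ofReal_mul hK, h.eq_add, h.eq_add]
  have hl := h.lipschitz x y i
  split_ifs with hij
  · subst hij
    rw [add_zero, add_sub_add_comm]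
    exact ENNReal.ofReal_le_ofReal ((norm_add_le _ _).trans hl)
  · rw [← ENNReal.ofReal_add (by positivity) (by positivity), add_sub_add_comm]
    refine ENNReal.ofReal_le_ofReal ((norm_add_le _ _).trans ?_)
    have h1 := norm_sub_le (bhat x i) (bhat y j)
    have h2 := h.bounded x i
    have h3 := h.bounded y j
    have h4 := norm_nonneg (bhat x i - bhat y i)
    linarith

theorem integrableOn_path (h : IsRegularDrift b bhat Z K₂) {x : ℝ≥0 → EuclideanSpace ℝ (Fin d)}
    (hx : Continuous x) {l : ℝ≥0 → Fin N} (hl : Measurable l) (t : ℝ≥0) :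
    IntegrableOn (fun s => b (x s) (l s)) (Set.Iic t) timeMeasure := by
  simp only [h.eq_add]
  refine Integrable.add ?_ ?_
  · have hmeas : Measurable fun s => bhat (x s) (l s) := by
      have h1 : Measurable fun p : EuclideanSpace ℝ (Fin d) × Fin N => bhat p.1 p.2 :=
        measurable_from_prod_countable_left fun i => (h.continuous_bhat i).measurable
      exact h1.comp (hx.measurable.prodMk hl)
    refine Measure.integrableOn_of_bounded (M := K₂) ?_ hmeas.aestronglyMeasurable
      (Eventually.of_forall fun s => h.bounded _ _)
    simp [timeMeasure_Iic]
  · have hc : IsCompact (Set.Iic t) := by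
      rw [← Set.Icc_bot]
      exact isCompact_Icc
    exact ((h.continuous_common (l 0)).comp hx).continuousOn.integrableOn_compact hc

end IsRegularDrift

namespace IsSolution

variable {bhat : EuclideanSpace ℝ (Fin d) → Fin N → EuclideanSpace ℝ (Fin d)}
  {Z : EuclideanSpace ℝ (Fin d) → EuclideanSpace ℝ (Fin d)} {K₂ : ℝ}

theorem ae_enorm_fst_sub_le (hb : IsRegularDrift b bhat Z K₂)
    (h : IsSolution P F B κ M b σ K Q x₀ i₀ X Λ)
    (h' : IsSolution P F B κ M b σ K Q' x₀ i₀ X' Λ') :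
    ∀ᵐ ω ∂P, ∀ t, ‖X t ω - X' t ω‖ₑ ≤ ∫⁻ s in Set.Iic t,
      (ENNReal.ofReal K₂ * ‖X s ω - X' s ω‖ₑ +
        if Λ s ω = Λ' s ω then 0 else ENNReal.ofReal (2 * K₂)) ∂timeMeasure := by
  filter_upwards [h.eq_fst, h'.eq_fst] with ω h1 h2 t
  have hi := hb.integrableOn_path (h.continuous_fst ω) (l := fun s => Λ s ω)
    (h.measurable_uncurry_snd.comp measurable_prodMk_left) t
  have hi' := hb.integrableOn_path (h'.continuous_fst ω) (l := fun s => Λ' s ω)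
    (h'.measurable_uncurry_snd.comp measurable_prodMk_left) t
  rw [h1 t, h2 t, add_sub_add_right_eq_sub, add_sub_add_left_eq_sub, ← integral_sub hi hi']
  exact (enorm_integral_le_lintegral_enorm _).trans
    (lintegral_mono fun s => hb.enorm_sub_le _ _ _ _)

/-- A crude bound, treating the regimes as different at all times. Being deterministic, it bounds
the mean distance a priori, as Grönwall's inequality requires, without moment estimates. The
pathwise application takes its own a priori bound from continuity on `[0, T]`. -/
theorem ae_enorm_fst_sub_le_of_le (hb : IsRegularDrift b bhat Z K₂)
    (h : IsSolution P F B κ M b σ K Q x₀ i₀ X Λ)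
    (h' : IsSolution P F B κ M b σ K Q' x₀ i₀ X' Λ') (T : ℝ≥0) :
    ∀ᵐ ω ∂P, ∀ t ≤ T, ‖X t ω - X' t ω‖ₑ ≤
      ENNReal.ofReal (2 * K₂ * T * Real.exp (K₂ * T)) := by
  have hK := hb.pos
  filter_upwards [h.ae_enorm_fst_sub_le hb h'] with ω hω
  have hcont : Continuous fun t => X t ω - X' t ω :=
    (h.continuous_fst ω).sub (h'.continuous_fst ω)
  obtain ⟨C, hC⟩ := (isCompact_Icc (a := (0 : ℝ≥0)) (b := T)).exists_bound_of_continuousOn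
    hcont.continuousOn
  have hgr := gronwall_lintegral (f := fun t => ‖X t ω - X' t ω‖ₑ) (a := 2 * K₂ * T) (c := K₂)
    (C := C) (T := T) (by positivity) hb.pos (fun t ht => ?_) (fun t ht => ?_)
  · intro t ht
    refine (hgr t ht).trans (ENNReal.ofReal_le_ofReal ?_)
    have : (t : ℝ) ≤ T := ht
    gcongr
  · rw [← ofReal_norm]
    exact ENNReal.ofReal_le_ofReal (hC t ⟨zero_le, ht⟩)
  · have hm : Measurable fun s => ENNReal.ofReal K₂ * ‖X s ω - X' s ω‖ₑ :=
      hcont.measurable.enorm.const_mul _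
    refine (hω t).trans ?_
    rw [lintegral_add_left hm, lintegral_const_mul _ hcont.measurable.enorm, add_comm]
    gcongr
    calc ∫⁻ s in Set.Iic t, (if Λ s ω = Λ' s ω then 0 else ENNReal.ofReal (2 * K₂)) ∂timeMeasure
        ≤ ∫⁻ _ in Set.Iic t, ENNReal.ofReal (2 * K₂) ∂timeMeasure := by
          refine lintegral_mono fun s => ?_
          split_ifs <;> simp
      _ = ENNReal.ofReal (2 * K₂) * t := by
          rw [lintegral_const, Measure.restrict_apply_univ, timeMeasure_Iic]
      _ ≤ ENNReal.ofReal (2 * K₂ * T) := by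
          rw [ENNReal.ofReal_mul (p := 2 * K₂) (by positivity), ENNReal.ofReal_coe_nnreal]
          gcongr

/-- The mean distance of the first components. -/
theorem lintegral_enorm_fst_sub_le [IsProbabilityMeasure P] (hb : IsRegularDrift b bhat Z K₂)
    (h : IsSolution P F B κ M b σ K Q x₀ i₀ X Λ)
    (h' : IsSolution P F B κ M b σ K Q' x₀ i₀ X' Λ') (t : ℝ≥0) :
    ∫⁻ ω, ‖X t ω - X' t ω‖ₑ ∂P ≤ ∫⁻ s in Set.Iic t,
      (ENNReal.ofReal K₂ * ∫⁻ ω, ‖X s ω - X' s ω‖ₑ ∂P +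
        ENNReal.ofReal (2 * K₂) * P {ω | Λ s ω ≠ Λ' s ω}) ∂timeMeasure := by
  have hdiff : Measurable fun p : Ω × ℝ≥0 => ‖X p.2 p.1 - X' p.2 p.1‖ₑ :=
    (h.measurable_uncurry_fst.sub h'.measurable_uncurry_fst).enorm
  have heq : MeasurableSet {p : Ω × ℝ≥0 | Λ p.2 p.1 = Λ' p.2 p.1} :=
    measurableSet_eq_fun h.measurable_uncurry_snd h'.measurable_uncurry_snd
  have hite : Measurable fun p : Ω × ℝ≥0 =>
      if Λ p.2 p.1 = Λ' p.2 p.1 then 0 else ENNReal.ofReal (2 * K₂) :=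
    Measurable.ite heq measurable_const measurable_const
  have hsum : Measurable (Function.uncurry fun ω s => ENNReal.ofReal K₂ * ‖X s ω - X' s ω‖ₑ +
      if Λ s ω = Λ' s ω then 0 else ENNReal.ofReal (2 * K₂)) :=
    (hdiff.const_mul _).add hite
  calc ∫⁻ ω, ‖X t ω - X' t ω‖ₑ ∂P
      ≤ ∫⁻ ω, ∫⁻ s in Set.Iic t, (ENNReal.ofReal K₂ * ‖X s ω - X' s ω‖ₑ +
          if Λ s ω = Λ' s ω then 0 else ENNReal.ofReal (2 * K₂)) ∂timeMeasure ∂P :=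
        lintegral_mono_ae ((h.ae_enorm_fst_sub_le hb h').mono fun ω hω => hω t)
    _ = ∫⁻ s in Set.Iic t, ∫⁻ ω, (ENNReal.ofReal K₂ * ‖X s ω - X' s ω‖ₑ +
          if Λ s ω = Λ' s ω then 0 else ENNReal.ofReal (2 * K₂)) ∂P ∂timeMeasure :=
        lintegral_lintegral_swap hsum.aemeasurable
    _ = _ := by
        refine lintegral_congr fun s => ?_
        have hs : Measurable fun ω => ‖X s ω - X' s ω‖ₑ :=
          ((h.measurable_fst s).sub (h'.measurable_fst s)).enorm
        have hne : MeasurableSet {ω | Λ s ω ≠ Λ' s ω} :=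
          (measurable_prodMk_right (y := s) heq).compl
        have hind : ∀ ω, (if Λ s ω = Λ' s ω then 0 else ENNReal.ofReal (2 * K₂)) =
            {ω | Λ s ω ≠ Λ' s ω}.indicator (fun _ => ENNReal.ofReal (2 * K₂)) ω := by
          intro ω
          by_cases hω : Λ s ω = Λ' s ω <;> simp [hω]
        simp only [hind]
        rw [lintegral_add_left (hs.const_mul _), lintegral_const_mul _ hs,
          lintegral_indicator_const hne]

theorem lintegral_enorm_fst_sub_le_rateGap [IsProbabilityMeasure P]
    (hb : IsRegularDrift b bhat Z K₂) (hM : IsFPoisson P F κ M)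
    (h : IsSolution P F B κ M b σ K Q x₀ i₀ X Λ)
    (h' : IsSolution P F B κ M b σ K Q' x₀ i₀ X' Λ')
    {K₃ : ℝ} (hK₃ : 0 ≤ K₃) (hQ : ∀ x y i j, |Q x i j - Q y i j| ≤ K₃ * ‖x - y‖)
    (hQ' : ∀ i j, Measurable fun x => Q' x i j) {T : ℝ≥0} (hT : 0 < T) {t : ℝ≥0} (ht : t ≤ T) :
    ∫⁻ ω, ‖X t ω - X' t ω‖ₑ ∂P ≤
      ENNReal.ofReal (2 * T * Real.exp ((K₂ + 2 * ((N : ℝ) - 1) * K₃) * T)) * rateGap Q' Q := by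
  have hK := hb.pos
  have hN : (0 : ℝ) ≤ (N : ℝ) - 1 := by
    have : (1 : ℝ) ≤ N := by exact_mod_cast Fin.pos i₀
    linarith
  -- If the gap is infinite, so is the right-hand side, because its prefactor is positive for `T >
  -- 0`.
  rcases eq_or_ne (rateGap Q' Q) ∞ with hgap | hgap
  · rw [hgap, ENNReal.mul_top]
    · exact le_top
    · rw [ne_eq, ENNReal.ofReal_eq_zero, not_le]
      have : (0 : ℝ) < T := hT
      positivity
  set θ : ℝ := (rateGap Q' Q).toReal with hθ
  have hθ0 : 0 ≤ θ := ENNReal.toReal_nonneg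
  have hgapθ : rateGap Q' Q = ENNReal.ofReal θ := (ENNReal.ofReal_toReal hgap).symm
  set u : ℝ≥0 → ℝ≥0∞ := fun s => ∫⁻ ω, ‖X s ω - X' s ω‖ₑ ∂P with hu
  set p : ℝ≥0 → ℝ≥0∞ := fun s => P {ω | Λ s ω ≠ Λ' s ω} with hp
  set c : ℝ := K₂ + 2 * ((N : ℝ) - 1) * K₃ with hc
  have hc0 : 0 < c := by positivity
  have hum : Measurable u :=
    ((h.measurable_uncurry_fst.sub h'.measurable_uncurry_fst).enorm :
      Measurable fun p : Ω × ℝ≥0 => ‖X p.2 p.1 - X' p.2 p.1‖ₑ).lintegral_prod_left'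
  have hpm : Measurable p := measurable_measure_prodMk_right
    (measurableSet_eq_fun h.measurable_uncurry_snd h'.measurable_uncurry_snd).compl
  have hu_le : ∀ s ≤ T, u s ≤ ENNReal.ofReal (2 * K₂ * T * Real.exp (K₂ * T)) := by
    intro s hs
    refine (lintegral_mono_ae ((h.ae_enorm_fst_sub_le_of_le hb h' T).mono
      fun ω hω => hω s hs)).trans ?_
    simp
  -- The weight `2` makes the drift term `2 K₂ p` equal to `K₂` times the summand `2 p`, so `K₂`
  -- enters the exponent only once.
  have hgr := gronwall_lintegral (f := fun s => u s + 2 * p s) (a := 2 * T * θ) (c := c)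
    (C := 2 * K₂ * T * Real.exp (K₂ * T) + 2) (T := T) (by positivity) hc0
    (fun s hs => ?_) (fun s hs => ?_) t ht
  · refine (le_self_add.trans hgr).trans ?_
    rw [hgapθ, ← ENNReal.ofReal_mul (by positivity)]
    refine ENNReal.ofReal_le_ofReal ?_
    have h1 : (t : ℝ) ≤ T := ht
    calc 2 * T * θ * Real.exp (c * t) ≤ 2 * T * θ * Real.exp (c * T) := by gcongr
      _ = 2 * T * Real.exp (c * T) * θ := by ring
  · rw [ENNReal.ofReal_add (by positivity) (by norm_num)]
    refine add_le_add (hu_le s hs) ?_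
    calc 2 * p s ≤ 2 * 1 := by
          gcongr
          exact prob_le_one
      _ = ENNReal.ofReal 2 := by simp
  · calc u s + 2 * p s
        ≤ ∫⁻ r in Set.Iic s, (ENNReal.ofReal K₂ * u r + ENNReal.ofReal (2 * K₂) * p r)
              ∂timeMeasure +
            2 * ∫⁻ r in Set.Iic s, (rateGap Q' Q + ENNReal.ofReal (((N : ℝ) - 1) * K₃) * u r)
              ∂timeMeasure :=
          add_le_add (h.lintegral_enorm_fst_sub_le hb h' s)
            (mul_le_mul_right (h.measure_snd_ne_le hM h' hK₃ hQ hQ' s) 2)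
      _ = ∫⁻ r in Set.Iic s, ((ENNReal.ofReal K₂ * u r + ENNReal.ofReal (2 * K₂) * p r) +
            2 * (rateGap Q' Q + ENNReal.ofReal (((N : ℝ) - 1) * K₃) * u r)) ∂timeMeasure := by
          rw [← lintegral_const_mul 2 (by fun_prop), ← lintegral_add_left (by fun_prop)]
      _ ≤ ∫⁻ r in Set.Iic s, (ENNReal.ofReal (2 * θ) + ENNReal.ofReal c * (u r + 2 * p r))
            ∂timeMeasure := by
          refine lintegral_mono fun r => ?_
          rw [hgapθ, hc, ENNReal.ofReal_mul (by norm_num : (0 : ℝ) ≤ 2),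
            ENNReal.ofReal_mul (by norm_num : (0 : ℝ) ≤ 2),
            ENNReal.ofReal_add (by positivity) (by positivity), mul_assoc (2 : ℝ),
            ENNReal.ofReal_mul (by norm_num : (0 : ℝ) ≤ 2), ENNReal.ofReal_ofNat]
          set a := ENNReal.ofReal (((N : ℝ) - 1) * K₃)
          set k := ENNReal.ofReal K₂
          -- The nonnegative term `2 a (2 p)` is added to complete the product `(k + 2 a) (u + 2
          -- p)`.
          calc k * u r + 2 * k * p r + 2 * (ENNReal.ofReal θ + a * u r)
              ≤ k * u r + 2 * k * p r + 2 * (ENNReal.ofReal θ + a * u r) + 2 * a * (2 * p r) :=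
                le_self_add
            _ = 2 * ENNReal.ofReal θ + (k + 2 * a) * (u r + 2 * p r) := by ring
      _ = ENNReal.ofReal (2 * θ) * s + ENNReal.ofReal c *
            ∫⁻ r in Set.Iic s, (u r + 2 * p r) ∂timeMeasure := by
          rw [lintegral_add_left measurable_const, lintegral_const_mul _ (by fun_prop),
            lintegral_const, Measure.restrict_apply_univ, timeMeasure_Iic]
      _ ≤ _ := by
          gcongr
          rw [show 2 * T * θ = 2 * θ * T by ring, ENNReal.ofReal_mul (p := 2 * θ) (by positivity),
            ENNReal.ofReal_coe_nnreal]
          gcongr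

end IsSolution

theorem W₁_map_le {P : Measure Ω} {X Y : Ω → EuclideanSpace ℝ (Fin d)} (hX : Measurable X)
    (hY : Measurable Y) : W₁ (P.map X) (P.map Y) ≤ ∫⁻ ω, ‖X ω - Y ω‖ₑ ∂P := by
  have hXY : Measurable fun ω => (X ω, Y ω) := hX.prodMk hY
  have h1 : (P.map fun ω => (X ω, Y ω)).map Prod.fst = P.map X :=
    Measure.map_map measurable_fst hXY
  have h2 : (P.map fun ω => (X ω, Y ω)).map Prod.snd = P.map Y :=
    Measure.map_map measurable_snd hXY
  refine (iInf₂_le (P.map fun ω => (X ω, Y ω)) ⟨h1, h2⟩).trans_eq ?_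
  rw [lintegral_map (by fun_prop) hXY]

end

end HybridSwitching

theorem theorem3p1
    {Ω : Type*} [mΩ : MeasurableSpace Ω] (P : Measure Ω) [IsProbabilityMeasure P]
    (F : Filtration ℝ≥0 mΩ) {d N : ℕ}
    -- the coefficients
    (σ : Matrix (Fin d) (Fin d) ℝ) (hσ : 0 < σ.det)
    (b bhat : EuclideanSpace ℝ (Fin d) → Fin N → EuclideanSpace ℝ (Fin d))
    (Z : EuclideanSpace ℝ (Fin d) → EuclideanSpace ℝ (Fin d))
    (hb : ∀ x i, b x i = bhat x i + Z x)
    (K₂ : ℝ) (hK₂ : 0 < K₂)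
    (hb_lip : ∀ x y i, ‖bhat x i - bhat y i‖ + ‖Z x - Z y‖ ≤ K₂ * ‖x - y‖)
    (hb_bdd : ∀ x i, ‖bhat x i‖ ≤ K₂)
    -- the rates and their threshold type approximations
    (Q : EuclideanSpace ℝ (Fin d) → Matrix (Fin N) (Fin N) ℝ) (hQ : ∀ x, IsQMatrix (Q x))
    (K₃ : ℝ) (hK₃ : 0 < K₃)
    (hQ_lip : ∀ x y i j, |Q x i j - Q y i j| ≤ K₃ * ‖x - y‖)
    (Qn : ℕ → EuclideanSpace ℝ (Fin d) → Matrix (Fin N) (Fin N) ℝ)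
    (hQn : ∀ n, IsRadialThreshold (Qn n) ∨ IsLineThreshold (Qn n))
    (hΘ : Tendsto (fun n => rateGap (Qn n) Q) atTop (𝓝 0))
    -- a common bound of all rates, and a mark space that contains all the intervals `Γ i j`
    (K₀ : ℝ) (hQ_bdd : ∀ x i, -Q x i i ≤ K₀) (hQn_bdd : ∀ n x i, -Qn n x i i ≤ K₀)
    (κ₁ : ℝ) (hκ₁ : (2 * (N : ℝ) - 1) * N * K₀ ≤ κ₁)
    -- the driving noise and the hybrid systems
    (B : ℝ≥0 → Ω → EuclideanSpace ℝ (Fin d)) (M : Ω → Measure (ℝ≥0 × ℝ))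
    (hBM : IsNoise P F B κ₁ M)
    (x₀ : EuclideanSpace ℝ (Fin d)) (i₀ : Fin N)
    (X : ℝ≥0 → Ω → EuclideanSpace ℝ (Fin d)) (Λ : ℝ≥0 → Ω → Fin N)
    (hX : IsSolution P F B κ₁ M b σ K₀ Q x₀ i₀ X Λ)
    (Xn : ℕ → ℝ≥0 → Ω → EuclideanSpace ℝ (Fin d)) (Λn : ℕ → ℝ≥0 → Ω → Fin N)
    (hXn : ∀ n, IsSolution P F B κ₁ M b σ K₀ (Qn n) x₀ i₀ (Xn n) (Λn n)) :
    (∀ (T : ℝ≥0), 0 < T → ∀ n : ℕ,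
      (⨆ t ∈ Set.Icc 0 T, W₁ (P.map (Xn n t)) (P.map (X t))) ≤
        ENNReal.ofReal (2 * T * Real.exp ((K₂ + 2 * ((N : ℝ) - 1) * K₃) * T)) *
          rateGap (Qn n) Q) ∧
    (∀ (T : ℝ≥0), 0 < T →
      Tendsto (fun n => ⨆ t ∈ Set.Icc 0 T, W₁ (P.map (Xn n t)) (P.map (X t)))
        atTop (𝓝 0)) := by
  have hdrift : IsRegularDrift b bhat Z K₂ := ⟨hK₂, hb, hb_lip, hb_bdd⟩
  have hbound : ∀ (T : ℝ≥0), 0 < T → ∀ n : ℕ,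
      (⨆ t ∈ Set.Icc 0 T, W₁ (P.map (Xn n t)) (P.map (X t))) ≤
        ENNReal.ofReal (2 * T * Real.exp ((K₂ + 2 * ((N : ℝ) - 1) * K₃) * T)) *
          rateGap (Qn n) Q := by
    intro T hT n
    refine iSup₂_le fun t ht => ?_
    refine (W₁_map_le ((hXn n).measurable_fst t) (hX.measurable_fst t)).trans ?_
    simp only [← enorm_sub_rev (X t _)]
    -- The limit system is the first one, since its rates are Lipschitz; the threshold form supplies
    -- measurability of the approximating rates.
    exact hX.lintegral_enorm_fst_sub_le_rateGap hdrift hBM.poisson (hXn n) hK₃.le hQ_lip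
      (fun i j => (hQn n).elim (fun h => h.measurable_apply i j) fun h => h.measurable_apply i j)
      hT ht.2
  refine ⟨hbound, fun T hT => ?_⟩
  refine tendsto_of_tendsto_of_tendsto_of_le_of_le tendsto_const_nhds ?_ (fun n => zero_le)
    (hbound T hT)
  have hlim := ENNReal.Tendsto.const_mul
    (a := ENNReal.ofReal (2 * T * Real.exp ((K₂ + 2 * ((N : ℝ) - 1) * K₃) * T))) hΘ
    (Or.inr ENNReal.ofReal_ne_top)
  rwa [mul_zero] at hlim
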